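/- Let $M$ be a pattern, that is, a finite (unrooted, unlabeled) tree with at least three nodes. Its nodes of degree at least $2$ are called internal, its leaves external. An occurrence of $M$ in a tree $T$ is a set of nodes of $T$ whose induced subgraph is isomorphic to $M$ in such a way that every internal node of $M$ corresponds to a node of $T$ of the same degree in $T$, while the external nodes of $M$ may correspond to nodes of arbitrary degree; overlapping occurrences are counted separately. A planted labeled tree of size $n$ is a rooted labeled tree with $n$ nodes to whose root an additional unlabeled phantom node is attached; the phantom node does not count for the size, but the edge to it counts for the degree of the root, and an occurrence of $M$ may use the phantom node as an external node. Let $p_{n,m}$ be the number of planted labeled trees of size $n$ with exactly $m$ occurrences of $M$, and let $$p(x,u)=\sum_{n,m\ge 0} p_{n,m}\frac{x^n u^m}{n!}.$$ Then there exist an integer $L\ge 0$, power series $a_0(x,u),\dots,a_L(x,u)$ with real coefficients and without constant term such that $$p(x,u)=\sum_{j=0}^{L}a_j(x,u),$$ and polynomials $P_j(y_0,\dots,y_L,u)$ $(1\le j\le L)$ with non-negative real coefficients such that $$a_0(x,u)=x\,e^{a_0(x,u)+\cdots+a_L(x,u)}-x\sum_{j=1}^{L}P_j\bigl(a_0(x,u),\dots,a_L(x,u),1\bigr),$$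 $$a_j(x,u)=x\,P_j\bigl(a_0(x,u),\dots,a_L(x,u),u\bigr)\qquad(1\le j\le L).$$ Furthermore, $$\sum_{j=1}^{L}P_j(y_0,\dots,y_L,1)\le_c e^{y_0+\cdots+y_L},$$ where $f\le_c g$ means that every Taylor coefficient of $f$ is at most the corresponding coefficient of $g$. Moreover, the dependency graph of the system is strongly connected: with $$F_0=x\,e^{y_0+\cdots+y_L}-x\sum_{j=1}^{L}P_j(y_0,\dots,y_L,1),\qquad F_j=x\,P_j(y_0,\dots,y_L,u)\quad(1\le j\le L),$$ the directed graph on $\{0,\dots,L\}$ that has an edge from $i$ to $j$ if and only if $y_j$ really occurs in the power series $F_i$ contains a directed path from every vertex to every vertex. -/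

import Mathlib

namespace TreePattern

noncomputable section

open scoped Nat

/-- The number of neighbours of a vertex. -/
def deg {V : Type*} (G : SimpleGraph V) (v : V) : ℕ := (G.neighborSet v).ncard

/-- `S` is (the vertex set of) an occurrence of the pattern `M` in the graph `G`: the induced
subgraph of `G` on `S` is a copy of `M` in which every internal node (a node of degree at least
two in `M`) has in `G` the same degree as in `M`; the leaves of `M` match nodes of any degree. -/
def IsOccurrence {W V : Type*} (M : SimpleGraph W) (G : SimpleGraph V) (S : Set V) : Prop :=
  ∃ f : M ↪g G, Set.range f = S ∧ ∀ w : W, 2 ≤ deg M w → deg G (f w) = deg M w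

/-- The number of occurrences of the pattern `M` in `G` (overlapping ones are all counted). -/
def occurrences {W V : Type*} (M : SimpleGraph W) (G : SimpleGraph V) : ℕ :=
  {S : Set V | IsOccurrence M G S}.ncard

/-- A planted labeled tree of size `n`: a tree on the `n` labels together with a root, to which
a phantom node (not counted in the size) is attached. -/
structure PlantedTree (n : ℕ) where
  graph : SimpleGraph (Fin n)
  isTree : graph.IsTree
  root : Fin n

/-- The tree on the `n` labeled nodes and the phantom node `none`, which is joined to the root. -/
def PlantedTree.plantedGraph {n : ℕ} (T : PlantedTree n) : SimpleGraph (Option (Fin n)) where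
  Adj a b := match a, b with
    | none, none => False
    | none, some b => b = T.root
    | some a, none => a = T.root
    | some a, some b => T.graph.Adj a b
  symm := by
    constructor
    rintro (_ | a) (_ | b) h
    · exact h
    · exact h
    · exact h
    · exact SimpleGraph.Adj.symm h
  loopless := by
    constructor
    rintro (_ | a) h
    · exact h
    · exact T.graph.irrefl h

/-- The number of planted labeled trees of size `n` with exactly `m` occurrences of `M`. An
occurrence may use the phantom node as an external node, and the phantom edge counts for the
degree of the root. -/
def plantedCount {W : Type*} (M : SimpleGraph W) (n m : ℕ) : ℕ :=
  {T : PlantedTree n | occurrences M T.plantedGraph = m}.ncard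

/-- Formal power series in the two variables `x` and `u` (numbered `0` and `1`). -/
abbrev SeriesXU : Type := MvPowerSeries (Fin 2) ℝ

/-- The variable `x`, which marks the size. -/
def varX : SeriesXU := MvPowerSeries.X 0

/-- The variable `u`, which marks the occurrences of the pattern. -/
def varU : SeriesXU := MvPowerSeries.X 1

/-- `p(x,u) = ∑ p_{n,m} xⁿ uᵐ / n!`. -/
def plantedSeries {W : Type*} (M : SimpleGraph W) : SeriesXU :=
  fun e => (plantedCount M (e 0) (e 1) : ℝ) / ((e 0)! : ℝ)

/-- `exp f` for a formal power series `f` without constant term. -/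
def expSeries {σ : Type*} (f : MvPowerSeries σ ℝ) : MvPowerSeries σ ℝ :=
  (PowerSeries.exp ℝ).subst f

/-- Every coefficient of `f` is at most the corresponding coefficient of `g`. -/
def CoeffLE {σ : Type*} (f g : MvPowerSeries σ ℝ) : Prop :=
  ∀ e : σ →₀ ℕ, MvPowerSeries.coeff e f ≤ MvPowerSeries.coeff e g

/-- Polynomials in `y_0, …, y_L` (the variables `some i`) and `u` (the variable `none`). -/
abbrev PolyYU (L : ℕ) : Type := MvPolynomial (Option (Fin (L + 1))) ℝ

/-- `P(b_0, …, b_L, v)` for elements `b_i`, `v` of a commutative `ℝ`-algebra. -/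
def PolyYU.evalAt {L : ℕ} {A : Type*} [CommRing A] [Algebra ℝ A] (P : PolyYU L)
    (b : Fin (L + 1) → A) (v : A) : A :=
  MvPolynomial.aeval (fun o : Option (Fin (L + 1)) => o.elim v b) P

/-- The variables of the right-hand sides `F_i(x, y_0, …, y_L, u)` of the system. -/
inductive SysVar (L : ℕ) : Type
  | x : SysVar L
  | y (i : Fin (L + 1)) : SysVar L
  | u : SysVar L

/-- The right-hand sides of the system:
`F_0 = x e^{y_0 + ⋯ + y_L} - x ∑_{j=1}^{L} P_j(y_0, …, y_L, 1)` and
`F_j = x P_j(y_0, …, y_L, u)` for `1 ≤ j ≤ L` (the polynomial `P_j` is `P (j - 1)` here). -/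
def rhs {L : ℕ} (P : Fin L → PolyYU L) : Fin (L + 1) → MvPowerSeries (SysVar L) ℝ :=
  let x : MvPowerSeries (SysVar L) ℝ := MvPowerSeries.X SysVar.x
  let y : Fin (L + 1) → MvPowerSeries (SysVar L) ℝ := fun i => MvPowerSeries.X (SysVar.y i)
  let u : MvPowerSeries (SysVar L) ℝ := MvPowerSeries.X SysVar.u
  Fin.cons (x * expSeries (∑ i, y i) - x * ∑ j, (P j).evalAt y 1)
    (fun j => x * (P j).evalAt y u)

/-- The power series `F` really depends on the variable `s`. -/
def DependsOn {σ : Type*} (F : MvPowerSeries σ ℝ) (s : σ) : Prop :=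
  ∃ e : σ →₀ ℕ, e s ≠ 0 ∧ MvPowerSeries.coeff e F ≠ 0

/-- The edge relation of the dependency graph of the system `y_i = F_i(x, y_0, …, y_L, u)`. -/
def DepEdge {L : ℕ} (F : Fin (L + 1) → MvPowerSeries (SysVar L) ℝ) (i j : Fin (L + 1)) : Prop :=
  DependsOn (F i) (SysVar.y j)

/-- A directed graph is strongly connected if there is a directed path from every vertex to
every vertex. -/
def StronglyConnected {V : Type*} (E : V → V → Prop) : Prop :=
  ∀ i j : V, Relation.ReflTransGen E i j

end

end TreePattern

/-! Each plane tree `t` receives the weight `wt t`, the product of `1/k!` over its nodes, where `k`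
is the number of children. A planted labeled tree can be drawn as a plane tree by ordering the
children of every node, and the drawings have total weight one (`tsum_wt_mul_labelCount`).
Conversely, a plane tree of size `n` carries `n!` labelings. Hence `p(x,u)` is the ordinary
generating function of plane trees weighted by `wt` (`plantedSeries_eq`).

An occurrence either lies in one branch of the root, with the root possibly serving as the phantom
node of that branch, or it is central: the root is an internal node of the pattern
(`occurrences_node`). The number of central occurrences depends on a bounded part of the tree.
Internal nodes have prescribed degree and are joined by paths of internal nodes shorter than `|W|`,
so nothing below depth `|W|`, or below a node with no or more than `|W|` children, is ever consulted
(`centralCount_trunc`).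

The finitely many truncated trees therefore serve as classes. The class of a tree with `k ≤ N`
children is determined by the classes of its branches, and all trees in a class have the same number
of central occurrences. Summing over the tuples of classes that graft to class `j` gives `P_j`.
Class `0` collects the trees whose root has `0` or more than `N` children; they have no central
occurrence, and their series is `x` times the exponential minus its terms of order `1` to `N`. At `u
= 1` the `P_j` add up to exactly those terms (`sum_evalAt_poly_one`), which yields the equation for
`a_0` and the coefficientwise bound.

For strong connectivity, the power `N + 1` in the exponential makes class `0` depend on every class,
and descending through a truncated tree to a node of class `0` leads from every class to `0`. -/

namespace TreePattern

noncomputable section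

open scoped Nat NNReal ENNReal

/-! ### Plane trees and their planted graphs on addresses -/

/-- Plane trees. -/
inductive PlaneTree : Type
  | node (k : ℕ) (f : Fin k → PlaneTree) : PlaneTree

namespace PlaneTree

/-- The number of nodes. -/
def size : PlaneTree → ℕ
  | node _ f => 1 + ∑ i, size (f i)

/-- The number of children of the root. -/
def arity : PlaneTree → ℕ
  | node k _ => k

/-- The tree with a single node. -/
def leaf : PlaneTree := node 0 Fin.elim0

/-- Cut off the subtrees at depth `d`, and those below nodes whose number of children does not
lie between `1` and `N`. -/
def trunc (N : ℕ) : ℕ → PlaneTree → PlaneTree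
  | 0, _ => leaf
  | d + 1, node k f => if 1 ≤ k ∧ k ≤ N then node k (fun i => trunc N d (f i)) else leaf

/-- Embedding of the planted `i`-th subtree into the planted tree; nodes are addressed by lists
of child indices, and `none` is the phantom node. -/
def branch (i : ℕ) : Option (List ℕ) → Option (List ℕ)
  | none => some []
  | some a => some (i :: a)

/-- `c` is a child of `p` in the planted tree. -/
def Edge : PlaneTree → Option (List ℕ) → Option (List ℕ) → Prop
  | node k f, p, c => (p = none ∧ c = some []) ∨
      ∃ (i : Fin k) (p' c' : Option (List ℕ)), p = branch i p' ∧ c = branch i c' ∧ Edge (f i) p' c'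

/-- Distance from the phantom node. -/
def depth : Option (List ℕ) → ℕ
  | none => 0
  | some a => a.length + 1

@[simp] theorem branch_none (i : ℕ) : branch i none = some [] := rfl

@[simp] theorem branch_some (i : ℕ) (a : List ℕ) : branch i (some a) = some (i :: a) := rfl

theorem branch_injective (i : ℕ) : Function.Injective (branch i) := by
  rintro (_ | a) (_ | b) h <;> simp_all [branch]

@[simp] theorem branch_ne_none (i : ℕ) (a : Option (List ℕ)) : branch i a ≠ none := by
  cases a <;> simp

theorem depth_branch (i : ℕ) (a : Option (List ℕ)) : depth (branch i a) = depth a + 1 := by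
  cases a <;> simp [depth]

theorem Edge.depth_eq : ∀ {t : PlaneTree} {p c : Option (List ℕ)}, Edge t p c →
    depth c = depth p + 1
  | node k f, p, c, h => by
    rw [Edge] at h
    rcases h with ⟨rfl, rfl⟩ | ⟨i, p', c', rfl, rfl, h⟩
    · simp [depth]
    · rw [depth_branch, depth_branch, h.depth_eq]

theorem Edge.ne_none {t : PlaneTree} {p c : Option (List ℕ)} (h : Edge t p c) : c ≠ none := by
  rintro rfl
  simpa [depth] using h.depth_eq

theorem edge_none {t : PlaneTree} {c : Option (List ℕ)} : Edge t none c ↔ c = some [] := by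
  cases t with
  | node k f =>
    rw [Edge]
    constructor
    · rintro (⟨-, rfl⟩ | ⟨i, p', c', h, -⟩)
      · rfl
      · exact absurd h.symm (branch_ne_none _ _)
    · rintro rfl
      exact Or.inl ⟨rfl, rfl⟩

theorem edge_cons {k : ℕ} {f : Fin k → PlaneTree} {p : Option (List ℕ)} {j : ℕ} {a : List ℕ} :
    Edge (node k f) p (some (j :: a)) ↔
      ∃ (h : j < k) (p' : Option (List ℕ)), p = branch j p' ∧ Edge (f ⟨j, h⟩) p' (some a) := by
  rw [Edge]
  constructor
  · rintro (⟨-, h⟩ | ⟨i, p', c', rfl, hc, h⟩)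
    · simp at h
    · cases c' with
      | none => exact absurd rfl h.ne_none
      | some c' =>
        simp only [branch_some, Option.some.injEq, List.cons.injEq] at hc
        obtain ⟨rfl, rfl⟩ := hc
        exact ⟨i.2, p', rfl, h⟩
  · rintro ⟨h, p', rfl, he⟩
    exact Or.inr ⟨⟨j, h⟩, p', some a, rfl, rfl, he⟩

theorem edge_root {t : PlaneTree} {p : Option (List ℕ)} : Edge t p (some []) ↔ p = none := by
  constructor
  · intro h
    have := h.depth_eq
    cases p with
    | none => rfl
    | some a => simp [depth] at this
  · rintro rfl
    exact edge_none.2 rfl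

/-- The planted tree on the addresses; all addresses that are not nodes are isolated. -/
def graph (t : PlaneTree) : SimpleGraph (Option (List ℕ)) where
  Adj a b := Edge t a b ∨ Edge t b a
  symm := ⟨fun _ _ h => h.symm⟩
  loopless := ⟨fun _ h => by rcases h with h | h <;> simpa using h.depth_eq⟩

theorem graph_adj {t : PlaneTree} {a b : Option (List ℕ)} :
    (graph t).Adj a b ↔ Edge t a b ∨ Edge t b a := Iff.rfl

theorem graph_adj_none {t : PlaneTree} {b : Option (List ℕ)} :
    (graph t).Adj none b ↔ b = some [] := by
  rw [graph_adj, edge_none]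
  exact or_iff_left fun h => h.ne_none rfl

theorem graph_adj_nil {k : ℕ} {f : Fin k → PlaneTree} {b : Option (List ℕ)} :
    (graph (node k f)).Adj (some []) b ↔ b = none ∨ ∃ i : Fin k, b = some [(i : ℕ)] := by
  rw [graph_adj, edge_root, or_comm]
  refine or_congr Iff.rfl ?_
  constructor
  · intro h
    match b, h with
    | none, h => exact absurd rfl h.ne_none
    | some [], h => simpa [depth] using h.depth_eq
    | some (j :: a), h =>
      obtain ⟨hj, p', hp, he⟩ := edge_cons.1 h
      cases p' with
      | none =>
        rw [edge_none] at he
        simp only [Option.some.injEq] at he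
        exact ⟨⟨j, hj⟩, by rw [he]⟩
      | some p' => simp at hp
  · rintro ⟨i, rfl⟩
    exact edge_cons.2 ⟨i.2, none, rfl, edge_none.2 rfl⟩

theorem edge_branch {k : ℕ} {f : Fin k → PlaneTree} {i : Fin k} {a b : Option (List ℕ)} :
    Edge (node k f) (branch i a) (branch i b) ↔ Edge (f i) a b := by
  cases b with
  | none => exact ⟨fun h => by simp [edge_root] at h, fun h => absurd rfl h.ne_none⟩
  | some b =>
    rw [branch_some, edge_cons]
    constructor
    · rintro ⟨_, p', hp, h⟩
      rwa [branch_injective _ hp]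
    · exact fun h => ⟨i.2, a, rfl, h⟩

theorem graph_adj_branch {k : ℕ} {f : Fin k → PlaneTree} {i : Fin k} {a b : Option (List ℕ)} :
    (graph (node k f)).Adj (branch i a) (branch i b) ↔ (graph (f i)).Adj a b := by
  rw [graph_adj, graph_adj, edge_branch, edge_branch]

theorem graph_adj_cons {k : ℕ} {f : Fin k → PlaneTree} {j : ℕ} {a : List ℕ}
    {b : Option (List ℕ)} :
    (graph (node k f)).Adj (some (j :: a)) b ↔
      ∃ (h : j < k) (b' : Option (List ℕ)), b = branch j b' ∧
        (graph (f ⟨j, h⟩)).Adj (some a) b' := by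
  constructor
  · rintro (h | h)
    · match b, h with
      | none, h => exact absurd rfl h.ne_none
      | some [], h => simp [edge_root] at h
      | some (l :: b), h =>
        obtain ⟨hl, p', hp, he⟩ := edge_cons.1 h
        cases p' with
        | none => simp at hp
        | some p' =>
          simp only [branch_some, Option.some.injEq, List.cons.injEq] at hp
          obtain ⟨rfl, rfl⟩ := hp
          exact ⟨hl, some b, rfl, Or.inl he⟩
    · obtain ⟨hj, p', rfl, he⟩ := edge_cons.1 h
      exact ⟨hj, p', rfl, Or.inr he⟩
  · rintro ⟨h, b', rfl, hb⟩
    exact (graph_adj_branch (i := ⟨j, h⟩) (a := some a)).2 hb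

/-- The vertex type contains all addresses and is infinite. Occurrences live in the support, so this
finiteness is what makes counting them by `ncard` meaningful. -/
theorem support_graph_finite : ∀ t : PlaneTree, (graph t).support.Finite
  | node k f => by
    have hsub : (graph (node k f)).support ⊆
        {none, some []} ∪ ⋃ i : Fin k, branch i '' (graph (f i)).support := by
      rintro (_ | _ | ⟨j, a⟩) h
      · simp
      · simp
      · obtain ⟨b, hb⟩ := h
        obtain ⟨hj, b', rfl, hb'⟩ := graph_adj_cons.1 hb
        exact Or.inr (Set.mem_iUnion.2 ⟨⟨j, hj⟩, some a, ⟨b', hb'⟩, rfl⟩)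
    refine Set.Finite.subset (Set.Finite.union (by simp) ?_) hsub
    exact Set.finite_iUnion fun i => (support_graph_finite (f i)).image _

theorem neighborSet_cons {k : ℕ} {f : Fin k → PlaneTree} {i : Fin k} {a : List ℕ} :
    (graph (node k f)).neighborSet (some (i :: a)) =
      branch i '' (graph (f i)).neighborSet (some a) := by
  ext b
  simp only [SimpleGraph.mem_neighborSet, graph_adj_cons, Set.mem_image]
  exact ⟨fun ⟨_, b', h, h'⟩ => ⟨b', h', h.symm⟩, fun ⟨b', h', h⟩ => ⟨i.2, b', h.symm, h'⟩⟩

theorem deg_cons {k : ℕ} {f : Fin k → PlaneTree} {i : Fin k} {a : List ℕ} :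
    deg (graph (node k f)) (some (i :: a)) = deg (graph (f i)) (some a) := by
  rw [deg, neighborSet_cons, Set.ncard_image_of_injective _ (branch_injective _), deg]

theorem deg_nil {k : ℕ} {f : Fin k → PlaneTree} :
    deg (graph (node k f)) (some []) = k + 1 := by
  have : (graph (node k f)).neighborSet (some []) =
      insert none (Set.range fun i : Fin k => some [(i : ℕ)]) := by
    ext b
    simp only [SimpleGraph.mem_neighborSet, graph_adj_nil, Set.mem_insert_iff, Set.mem_range]
    exact or_congr Iff.rfl (exists_congr fun i => eq_comm)
  rw [deg, this, Set.ncard_insert_of_notMem (by simp)]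
  rw [← Set.image_univ, Set.ncard_image_of_injective _ (fun i j h => by simpa [Fin.ext_iff] using h)]
  simp [Set.ncard_univ]

theorem deg_none {t : PlaneTree} : deg (graph t) none = 1 := by
  have : (graph t).neighborSet none = {some []} := by
    ext b
    simp [graph_adj_none]
  rw [deg, this, Set.ncard_singleton]

end PlaneTree

/-! ### Splitting the occurrences at the root -/

theorem two_le_deg_iff {V : Type*} {G : SimpleGraph V} {v : V} (h : (G.neighborSet v).Finite) :
    2 ≤ deg G v ↔ ∃ x y, G.Adj v x ∧ G.Adj v y ∧ x ≠ y := by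
  rw [deg, Nat.succ_le_iff, Set.one_lt_ncard h]
  simp only [SimpleGraph.mem_neighborSet]
  exact ⟨fun ⟨x, hx, y, hy, h⟩ => ⟨x, y, hx, hy, h⟩, fun ⟨x, y, hx, hy, h⟩ => ⟨x, hx, y, hy, h⟩⟩

theorem IsOccurrence.ncard {W V : Type*} {M : SimpleGraph W} {G : SimpleGraph V} {S : Set V}
    (h : IsOccurrence M G S) : S.ncard = Nat.card W := by
  obtain ⟨f, rfl, -⟩ := h
  rw [← Set.image_univ, Set.ncard_image_of_injective _ f.injective, Set.ncard_univ]

theorem IsOccurrence.subset_support {W V : Type*} {M : SimpleGraph W} {G : SimpleGraph V}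
    {S : Set V} [Nontrivial W] (hM : M.Connected) (h : IsOccurrence M G S) : S ⊆ G.support := by
  obtain ⟨f, rfl, -⟩ := h
  rintro _ ⟨w, rfl⟩
  obtain ⟨w', hw'⟩ := hM.preconnected.exists_adj_of_nontrivial w
  exact ⟨f w', f.map_rel_iff.2 hw'⟩

namespace PlaneTree

variable {W : Type*} [Fintype W] {M : SimpleGraph W}

/-- The occurrences in which the root is an internal node of the pattern. -/
def IsCentral (M : SimpleGraph W) (t : PlaneTree) (S : Set (Option (List ℕ))) : Prop :=
  ∃ f : M ↪g graph t, Set.range f = S ∧ (∀ w : W, 2 ≤ deg M w → deg (graph t) (f w) = deg M w) ∧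
    ∃ w, 2 ≤ deg M w ∧ f w = some []

/-- The number of occurrences in which the root is an internal node of the pattern. -/
def centralCount (M : SimpleGraph W) (t : PlaneTree) : ℕ :=
  {S | IsCentral M t S}.ncard

omit [Fintype W] in
theorem IsCentral.isOccurrence {t : PlaneTree} {S : Set (Option (List ℕ))}
    (h : IsCentral M t S) : IsOccurrence M (graph t) S := by
  obtain ⟨f, hf, hd, -⟩ := h
  exact ⟨f, hf, hd⟩

omit [Fintype W] in
theorem finite_occurrences [Nontrivial W] (hM : M.Connected) (t : PlaneTree) :
    {S | IsOccurrence M (graph t) S}.Finite :=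
  (support_graph_finite t).finite_subsets.subset fun _ h => h.subset_support hM

/-- An internal pattern node has two neighbours. Inside one branch the root plays the phantom node,
whose only neighbour is the root of that branch. -/
theorem not_isCentral_image {k : ℕ} {f : Fin k → PlaneTree} {i : Fin k}
    {S : Set (Option (List ℕ))} : ¬ IsCentral M (node k f) (branch i '' S) := by
  rintro ⟨g, hg, -, w, hw, hgw⟩
  obtain ⟨x, y, hx, hy, hxy⟩ := (two_le_deg_iff (Set.toFinite _)).1 hw
  have key : ∀ z, M.Adj w z → g z = some [(i : ℕ)] := by
    intro z hz
    obtain ⟨z', -, hz'⟩ : g z ∈ branch i '' S := hg ▸ ⟨z, rfl⟩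
    have h := g.map_rel_iff.2 hz
    rw [hgw, ← hz', ← branch_none i, graph_adj_branch, graph_adj_none] at h
    rw [← hz', h, branch_some]
  exact hxy (g.injective ((key x hx).trans (key y hy).symm))

/-- Grafting changes the degree only of the phantom node of the branch. That node has a single
neighbour, so it can match only a leaf of the pattern, where the degree is free. -/
theorem isOccurrence_image {k : ℕ} {f : Fin k → PlaneTree} (i : Fin k)
    {S : Set (Option (List ℕ))} (h : IsOccurrence M (graph (f i)) S) :
    IsOccurrence M (graph (node k f)) (branch i '' S) := by
  obtain ⟨g, rfl, hd⟩ := h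
  refine ⟨⟨⟨fun w => branch i (g w), (branch_injective i).comp g.injective⟩, ?_⟩, ?_, ?_⟩
  · intro a b
    exact graph_adj_branch.trans g.map_rel_iff
  · exact Set.range_comp (branch i) g
  · intro w hw
    change deg _ (branch i (g w)) = _
    cases hgw : g w with
    | some a => rw [branch_some, deg_cons, ← hd w hw, hgw]
    | none =>
      exfalso
      obtain ⟨x, y, hx, hy, hxy⟩ := (two_le_deg_iff (Set.toFinite _)).1 hw
      have h1 := g.map_rel_iff.2 hx
      have h2 := g.map_rel_iff.2 hy
      rw [hgw, graph_adj_none] at h1 h2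
      exact hxy (g.injective (h1.trans h2.symm))

/-- The root separates the branches. If it is at most an external node of the occurrence, a
connected occurrence cannot pass through it from one branch to another. -/
theorem exists_image_of_not_isCentral (hM : M.Connected) (hcard : 3 ≤ Fintype.card W) {k : ℕ}
    {f : Fin k → PlaneTree} {S : Set (Option (List ℕ))}
    (h : IsOccurrence M (graph (node k f)) S) (hS : ¬ IsCentral M (node k f) S) :
    ∃ (i : Fin k) (S' : Set (Option (List ℕ))), IsOccurrence M (graph (f i)) S' ∧
      branch i '' S' = S := by
  have : Nontrivial W := Fintype.one_lt_card_iff_nontrivial.1 (by omega)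
  have hsupp := h.subset_support hM
  obtain ⟨g, rfl, hd⟩ := h
  have hroot : ∀ w, g w = some [] → ∀ x y, M.Adj w x → M.Adj w y → x = y := by
    intro w hw x y hx hy
    by_contra hxy
    exact hS ⟨g, rfl, hd, w, (two_le_deg_iff (Set.toFinite _)).2 ⟨x, y, hx, hy, hxy⟩, hw⟩
  -- Three pattern nodes cannot all fit into the phantom node and the root.
  obtain ⟨w₀, hw₀⟩ : ∃ w, g w ∉ ({none, some []} : Finset (Option (List ℕ))) := by
    by_contra! hcon
    have := Finset.card_le_card_of_injOn g (s := Finset.univ) (t := {none, some []})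
      (fun w _ => hcon w) g.injective.injOn
    have h2 : ({none, some []} : Finset (Option (List ℕ))).card = 2 := by simp
    rw [h2, Finset.card_univ] at this
    omega
  obtain ⟨j, a₀, hj₀⟩ : ∃ j a, g w₀ = some (j :: a) := by
    match hg : g w₀ with
    | none => simp [hg] at hw₀
    | some [] => simp [hg] at hw₀
    | some (j :: a) => exact ⟨j, a, rfl⟩
  have hjk : j < k := by
    obtain ⟨b, hb⟩ := hsupp ⟨w₀, rfl⟩
    rw [hj₀] at hb
    exact (graph_adj_cons.1 hb).1
  -- Invariant along walks from `w₀`: the image lies in branch `j`, or it is the root and already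
  -- has a neighbour in branch `j`. By `hroot` that neighbour is the only one, so the next step
  -- returns to the branch.
  have hall : ∀ w, Relation.ReflTransGen M.Adj w₀ w →
      (∃ a, g w = some (j :: a)) ∨ (g w = some [] ∧ ∃ w' a, M.Adj w w' ∧ g w' = some (j :: a)) := by
    intro w hw
    induction hw with
    | refl => exact Or.inl ⟨a₀, hj₀⟩
    | @tail b c _ hbc ih =>
      rcases ih with ⟨a, ha⟩ | ⟨hb, w', a, hbw', ha⟩
      · have h := g.map_rel_iff.2 hbc
        rw [ha, graph_adj_cons] at h
        obtain ⟨_, b', hb', h⟩ := h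
        cases b' with
        | none => exact Or.inr ⟨hb', b, a, hbc.symm, ha⟩
        | some b' => exact Or.inl ⟨b', hb'⟩
      · rw [hroot b hb c w' hbc hbw']
        exact Or.inl ⟨a, ha⟩
  have hbr : ∀ w, ∃ b, branch j b = g w := by
    intro w
    rcases hall w ((SimpleGraph.reachable_iff_reflTransGen _ _).1 (hM.preconnected w₀ w)) with
      ⟨a, ha⟩ | ⟨ha, -⟩
    · exact ⟨some a, ha.symm⟩
    · exact ⟨none, ha.symm⟩
  choose g' hg' using hbr
  refine ⟨⟨j, hjk⟩, Set.range g', ⟨⟨⟨g', ?_⟩, ?_⟩, rfl, ?_⟩, ?_⟩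
  · intro x y hxy
    exact g.injective (by rw [← hg', ← hg', hxy])
  · intro a b
    change (graph _).Adj (g' a) (g' b) ↔ _
    rw [← graph_adj_branch (i := ⟨j, hjk⟩), hg', hg']
    exact g.map_rel_iff
  · intro w hw
    change deg _ (g' w) = _
    rw [← hd w hw]
    cases hgw : g' w with
    | some a => rw [← hg' w, hgw]; exact (deg_cons (i := ⟨j, hjk⟩)).symm
    | none =>
      obtain ⟨x, y, hx, hy, hxy⟩ := (two_le_deg_iff (Set.toFinite _)).1 hw
      exact absurd (hroot w (by rw [← hg' w, hgw, branch_none]) x y hx hy) hxy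
  · rw [← Set.range_comp]
    exact congrArg Set.range (funext hg')

theorem occurrences_node (hM : M.Connected) (hcard : 3 ≤ Fintype.card W) (k : ℕ)
    (f : Fin k → PlaneTree) :
    occurrences M (graph (node k f)) =
      ∑ i, occurrences M (graph (f i)) + centralCount M (node k f) := by
  have : Nontrivial W := Fintype.one_lt_card_iff_nontrivial.1 (by omega)
  have hset : {S | IsOccurrence M (graph (node k f)) S} =
      (⋃ i : Fin k, Set.image (branch i) '' {S | IsOccurrence M (graph (f i)) S}) ∪
        {S | IsCentral M (node k f) S} := by
    ext S
    constructor
    · intro h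
      by_cases hS : IsCentral M (node k f) S
      · exact Or.inr hS
      · obtain ⟨i, S', h', rfl⟩ := exists_image_of_not_isCentral hM hcard h hS
        exact Or.inl (Set.mem_iUnion.2 ⟨i, S', h', rfl⟩)
    · rintro (h | h)
      · obtain ⟨i, S', h', rfl⟩ := Set.mem_iUnion.1 h
        exact isOccurrence_image i h'
      · exact h.isOccurrence
  have hfin : ∀ i : Fin k,
      (Set.image (branch i) '' {S | IsOccurrence M (graph (f i)) S}).Finite :=
    fun i => (finite_occurrences hM _).image _
  rw [occurrences, hset, Set.ncard_union_eq _ (Set.finite_iUnion hfin)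
    ((finite_occurrences hM (node k f)).subset fun _ h => h.isOccurrence),
    Set.ncard_iUnion_of_finite hfin, finsum_eq_sum_of_fintype, centralCount]
  · congr 1
    refine Finset.sum_congr rfl fun i _ => ?_
    exact Set.ncard_image_of_injective _ (branch_injective i).image_injective
  · intro i j hij
    rw [Function.onFun, Set.disjoint_left]
    rintro _ ⟨S, hS, rfl⟩ ⟨S', hS', hSS⟩
    apply hij
    -- The images of different branches share only the root, the image of the phantom node. A node
    -- other than the phantom exists by cardinality, and its address reveals the branch.
    obtain ⟨a, haS, ha⟩ : ∃ a ∈ S, a ≠ none := by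
      have hc := IsOccurrence.ncard hS
      obtain ⟨a, ha, b, hb, hab⟩ := (Set.one_lt_ncard (Set.finite_of_ncard_pos
        (by rw [hc, Nat.card_eq_fintype_card]; omega))).1
        (by rw [hc, Nat.card_eq_fintype_card]; omega)
      by_cases h : a = none
      · exact ⟨b, hb, fun h' => hab (h.trans h'.symm)⟩
      · exact ⟨a, ha, h⟩
    obtain ⟨b, -, hb⟩ : branch i a ∈ branch j '' S' := by
      rw [hSS]
      exact ⟨a, haS, rfl⟩
    cases a with
    | none => exact absurd rfl ha
    | some a =>
      cases b with
      | none => simp at hb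
      | some b =>
        simp only [branch_some, Option.some.injEq, List.cons.injEq] at hb
        exact Fin.ext hb.1.symm
  · rw [Set.disjoint_left]
    rintro S hS hc
    obtain ⟨i, S', -, rfl⟩ := Set.mem_iUnion.1 hS
    exact not_isCentral_image hc

end PlaneTree

/-! ### Central occurrences see only a truncated tree -/

namespace PlaneTree

/-- The node `a` and all its ancestors have between `1` and `N` children. -/
def Explored (N : ℕ) : PlaneTree → List ℕ → Prop
  | node k _, [] => 1 ≤ k ∧ k ≤ N
  | node k f, i :: a => (1 ≤ k ∧ k ≤ N) ∧ ∃ h : i < k, Explored N (f ⟨i, h⟩) a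

theorem graph_trunc_adj_of_explored {N : ℕ} : ∀ {t : PlaneTree} {a : List ℕ} {d : ℕ},
    Explored N t a → a.length < d → ∀ b,
      (graph (trunc N d t)).Adj (some a) b ↔ (graph t).Adj (some a) b
  | node k f, [], d + 1, h, _, b => by
    rw [Explored] at h
    rw [trunc, if_pos h, graph_adj_nil, graph_adj_nil]
  | node k f, i :: a, d + 1, h, hd, b => by
    rw [Explored] at h
    obtain ⟨hk, hi, h⟩ := h
    rw [trunc, if_pos hk, graph_adj_cons, graph_adj_cons]
    refine exists_congr fun _ => exists_congr fun b' => and_congr Iff.rfl ?_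
    exact graph_trunc_adj_of_explored h (by simpa using hd) b'

/-- Degree at least two excludes the phantom node and the childless nodes. Since the degree is one
more than the number of children, the bound `N + 1` gives at most `N` children. -/
theorem Explored.adj {N : ℕ} : ∀ {t : PlaneTree} {a : List ℕ} {b : Option (List ℕ)},
    Explored N t a → (graph t).Adj (some a) b → 2 ≤ deg (graph t) b →
      deg (graph t) b ≤ N + 1 →
      ∃ b', b = some b' ∧ Explored N t b' ∧ b'.length ≤ a.length + 1
  | node k f, [], b, h, hab, h2, hN => by
    rw [Explored] at h
    rcases graph_adj_nil.1 hab with rfl | ⟨i, rfl⟩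
    · rw [deg_none] at h2
      omega
    · refine ⟨[(i : ℕ)], rfl, ?_, by simp⟩
      rw [deg_cons] at h2 hN
      cases hf : f i with
      | node l g =>
        rw [hf, deg_nil] at h2 hN
        refine ⟨h, i.2, ?_⟩
        rw [Fin.eta, hf, Explored]
        omega
  | node k f, i :: a, b, h, hab, h2, hN => by
    rw [Explored] at h
    obtain ⟨hk, hi, h⟩ := h
    obtain ⟨_, b', rfl, hb'⟩ := graph_adj_cons.1 hab
    cases b' with
    | none => exact ⟨[], rfl, hk, by simp⟩
    | some b' =>
      rw [branch_some, deg_cons (i := ⟨i, hi⟩)] at h2 hN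
      obtain ⟨b'', hb'', he, hl⟩ := h.adj hb' h2 hN
      obtain rfl := Option.some.inj hb''
      exact ⟨i :: b', rfl, ⟨hk, hi, he⟩, by simpa using hl⟩

theorem not_explored_leaf {N : ℕ} {a : List ℕ} : ¬ Explored N leaf a := by
  cases a with
  | nil => rw [leaf, Explored]; omega
  | cons i a => rw [leaf, Explored]; omega

theorem Explored.of_trunc {N : ℕ} : ∀ {d : ℕ} {t : PlaneTree} {a : List ℕ},
    Explored N (trunc N d t) a → Explored N t a ∧ a.length < d
  | 0, t, a, h => absurd h (by rw [trunc]; exact not_explored_leaf)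
  | d + 1, node k f, a, h => by
    rw [trunc] at h
    split_ifs at h with hk
    · cases a with
      | nil => exact ⟨hk, by simp⟩
      | cons i a =>
        obtain ⟨-, hi, h⟩ := h
        obtain ⟨h1, h2⟩ := Explored.of_trunc h
        exact ⟨⟨hk, hi, h1⟩, by simpa using h2⟩
    · exact absurd h not_explored_leaf

theorem edge_leaf {p c : Option (List ℕ)} : Edge leaf p c ↔ p = none ∧ c = some [] := by
  rw [leaf, Edge]
  exact or_iff_left fun ⟨i, _⟩ => i.elim0

theorem edge_none_nil (t : PlaneTree) : Edge t none (some []) := edge_none.2 rfl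

theorem Edge.of_trunc {N : ℕ} : ∀ {d : ℕ} {t : PlaneTree} {p c : Option (List ℕ)},
    Edge (trunc N d t) p c → Edge t p c
  | 0, t, p, c, h => by
    rw [trunc, edge_leaf] at h
    obtain ⟨rfl, rfl⟩ := h
    exact edge_none_nil t
  | d + 1, node k f, p, c, h => by
    rw [trunc] at h
    split_ifs at h with hk
    · rw [Edge] at h
      rcases h with ⟨rfl, rfl⟩ | ⟨i, p', c', rfl, rfl, h⟩
      · exact edge_none_nil _
      · exact edge_branch.2 h.of_trunc
    · obtain ⟨rfl, rfl⟩ := edge_leaf.1 h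
      exact edge_none_nil _

theorem Edge.parent_unique {t : PlaneTree} {p q c : Option (List ℕ)} (h : Edge t p c)
    (h' : Edge t q c) : p = q := by
  induction t generalizing p q c with
  | node k f ih =>
    match c with
    | none => exact absurd rfl h.ne_none
    | some [] => rw [edge_root.1 h, edge_root.1 h']
    | some (i :: a) =>
      obtain ⟨_, p', rfl, he⟩ := edge_cons.1 h
      obtain ⟨_, q', rfl, he'⟩ := edge_cons.1 h'
      rw [ih _ he he']

theorem Edge.exists_parent : ∀ {t : PlaneTree} {p c : Option (List ℕ)},
    Edge t p c → p ≠ none → ∃ q, Edge t q p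
  | node k f, p, c, h, hp => by
    rw [Edge] at h
    rcases h with ⟨rfl, rfl⟩ | ⟨i, p', c', rfl, rfl, h⟩
    · exact absurd rfl hp
    · by_cases hp' : p' = none
      · subst hp'
        exact ⟨none, edge_none_nil _⟩
      · obtain ⟨q, hq⟩ := h.exists_parent hp'
        exact ⟨branch i q, edge_branch.2 hq⟩

/-- Truncation only deletes edges. A node other than the phantom that survives keeps its edge to its
unique parent, so no edge between two surviving nodes is lost. -/
theorem graph_trunc_adj_of_mem_support {N d : ℕ} {t : PlaneTree} {a b : Option (List ℕ)}
    (ha : a ∈ (graph (trunc N d t)).support) (hb : b ∈ (graph (trunc N d t)).support) :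
    (graph (trunc N d t)).Adj a b ↔ (graph t).Adj a b := by
  have key : ∀ {p c}, c ∈ (graph (trunc N d t)).support → Edge t p c →
      Edge (trunc N d t) p c := by
    rintro p c ⟨x, hx⟩ h
    obtain ⟨q, hq⟩ : ∃ q, Edge (trunc N d t) q c := by
      rcases hx with hx | hx
      · exact hx.exists_parent h.ne_none
      · exact ⟨x, hx⟩
    rwa [h.parent_unique hq.of_trunc]
  exact ⟨Or.imp Edge.of_trunc Edge.of_trunc, Or.imp (key hb) (key ha)⟩

variable {W : Type*} [Fintype W] {M : SimpleGraph W}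

/-- Interior nodes of a path have two distinct neighbours and are therefore internal in the pattern.
Their prescribed degrees let exploration advance along the path one node at a time. -/
theorem explored_of_path {N : ℕ} (hN : Fintype.card W ≤ N) {t : PlaneTree} (g : M ↪g graph t)
    (hg : ∀ w : W, 2 ≤ deg M w → deg (graph t) (g w) = deg M w) {v w : W} (p : M.Walk v w)
    (hp : p.IsPath) (hw : 2 ≤ deg M w) {a : List ℕ} (ha : g v = some a) (he : Explored N t a) :
    ∃ b, g w = some b ∧ Explored N t b ∧ b.length ≤ a.length + p.length := by
  induction p generalizing a with
  | nil => exact ⟨a, ha, he, by simp⟩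
  | @cons v v' w h p ih =>
    rw [SimpleGraph.Walk.cons_isPath_iff] at hp
    have hv' : 2 ≤ deg M v' := by
      cases p with
      | nil => exact hw
      | @cons _ v'' _ h' p =>
        refine (two_le_deg_iff (Set.toFinite _)).2 ⟨v, v'', h.symm, h', ?_⟩
        rintro rfl
        exact hp.2 (by simp)
    have hadj := g.map_rel_iff.2 h
    have hdeg : deg (graph t) (g v') ≤ N + 1 := by
      rw [hg v' hv', deg]
      have := Set.ncard_le_card (M.neighborSet v')
      rw [Nat.card_eq_fintype_card] at this
      omega
    rw [ha] at hadj
    obtain ⟨b, hb, he', hl⟩ := he.adj hadj (by rw [hg v' hv']; exact hv') hdeg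
    obtain ⟨c, hc, hce, hcl⟩ := ih hp.1 hw hb he'
    refine ⟨c, hc, hce, ?_⟩
    rw [SimpleGraph.Walk.length_cons]
    omega

/-- The root has degree `k + 1`, the phantom edge included, and this equals the degree of an
internal pattern node, which lies between `2` and `|W| - 1`. -/
theorem explored_nil {N : ℕ} (hN : Fintype.card W ≤ N)
    {t : PlaneTree} (g : M ↪g graph t)
    (hg : ∀ w : W, 2 ≤ deg M w → deg (graph t) (g w) = deg M w) {w₀ : W} (hw₀ : 2 ≤ deg M w₀)
    (h₀ : g w₀ = some []) : Explored N t [] := by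
  have hdeg := hg w₀ hw₀
  cases t with
  | node k f =>
    rw [h₀, deg_nil] at hdeg
    rw [Explored]
    rw [deg] at hdeg hw₀
    have hlt : (M.neighborSet w₀).ncard < Fintype.card W := by
      rw [← Nat.card_eq_fintype_card, ← Set.ncard_univ]
      exact Set.ncard_lt_ncard (Set.ssubset_univ_iff.2 fun h =>
        M.irrefl (h ▸ Set.mem_univ w₀ : w₀ ∈ M.neighborSet w₀))
    omega

theorem explored_of_central (hM : M.Connected) {N : ℕ} (hN : Fintype.card W ≤ N)
    {t : PlaneTree} (g : M ↪g graph t)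
    (hg : ∀ w : W, 2 ≤ deg M w → deg (graph t) (g w) = deg M w) {w₀ : W} (hw₀ : 2 ≤ deg M w₀)
    (h₀ : g w₀ = some []) {w : W} (hw : 2 ≤ deg M w) :
    ∃ b, g w = some b ∧ Explored N t b ∧ b.length < Fintype.card W := by
  classical
  obtain ⟨p, hp⟩ := (hM.preconnected w₀ w).exists_isPath
  obtain ⟨b, hb, hbe, hbl⟩ := explored_of_path hN g hg p hp hw h₀
    (explored_nil hN g hg hw₀ h₀)
  have := hp.length_lt
  exact ⟨b, hb, hbe, by simp at hbl; omega⟩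

omit [Fintype W] in
theorem IsCentral.congr {t t' : PlaneTree} {S : Set (Option (List ℕ))} (g : M ↪g graph t)
    (hS : Set.range g = S) (hg : ∀ w : W, 2 ≤ deg M w → deg (graph t) (g w) = deg M w)
    {w₀ : W} (hw₀ : 2 ≤ deg M w₀) (h₀ : g w₀ = some [])
    (hdeg : ∀ w, 2 ≤ deg M w → ∀ b, (graph t').Adj (g w) b ↔ (graph t).Adj (g w) b)
    (hadj : ∀ v w, (graph t').Adj (g v) (g w) ↔ (graph t).Adj (g v) (g w)) :
    IsCentral M t' S := by
  refine ⟨⟨⟨g, g.injective⟩, (hadj _ _).trans g.map_rel_iff⟩, hS, fun w hw => ?_, w₀, hw₀, h₀⟩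
  rw [← hg w hw]
  change ((graph t').neighborSet (g w)).ncard = _
  rw [deg]
  congr 1
  ext b
  exact hdeg w hw b

theorem isCentral_trunc (hM : M.Connected) (hcard : 3 ≤ Fintype.card W) {N d : ℕ}
    (hN : Fintype.card W ≤ N) (hd : Fintype.card W ≤ d) (t : PlaneTree)
    (S : Set (Option (List ℕ))) : IsCentral M (trunc N d t) S ↔ IsCentral M t S := by
  have : Nontrivial W := Fintype.one_lt_card_iff_nontrivial.1 (by omega)
  -- Every edge of the pattern has an internal end: an edge between two leaves would be the whole
  -- connected pattern, which has at least three nodes.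
  have hpair : ∀ v w, M.Adj v w → 2 ≤ deg M v ∨ 2 ≤ deg M w := by
    intro v w hvw
    by_contra! hcon
    have hv : ∀ x, M.Adj v x → x = w := fun x hx => by
      by_contra hxw
      exact absurd ((two_le_deg_iff (Set.toFinite _)).2 ⟨x, w, hx, hvw, hxw⟩) (by omega)
    have hw : ∀ x, M.Adj w x → x = v := fun x hx => by
      by_contra hxv
      exact absurd ((two_le_deg_iff (Set.toFinite _)).2 ⟨x, v, hx, hvw.symm, hxv⟩) (by omega)
    have hall : ∀ x, Relation.ReflTransGen M.Adj v x → x = v ∨ x = w := by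
      intro x hx
      induction hx with
      | refl => exact Or.inl rfl
      | tail _ hbc ih =>
        rcases ih with rfl | rfl
        · exact Or.inr (hv _ hbc)
        · exact Or.inl (hw _ hbc)
    classical
    have : Fintype.card W ≤ ({v, w} : Finset W).card := by
      refine Finset.card_le_card fun x _ => ?_
      simpa using hall x ((SimpleGraph.reachable_iff_reflTransGen _ _).1 (hM.preconnected v x))
    have := this.trans Finset.card_le_two
    omega
  constructor
  · rintro ⟨g, hS, hg, w₀, hw₀, h₀⟩
    refine IsCentral.congr g hS hg hw₀ h₀ ?_ ?_
    · intro w hw b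
      obtain ⟨a, ha, he, -⟩ := explored_of_central hM hN g hg hw₀ h₀ hw
      obtain ⟨h1, h2⟩ := he.of_trunc
      rw [ha]
      exact (graph_trunc_adj_of_explored h1 h2 b).symm
    · intro v w
      have hs : ∀ x, g x ∈ (graph (trunc N d t)).support := fun x => by
        obtain ⟨y, hy⟩ := hM.preconnected.exists_adj_of_nontrivial x
        exact ⟨g y, g.map_rel_iff.2 hy⟩
      exact (graph_trunc_adj_of_mem_support (hs v) (hs w)).symm
  · rintro ⟨g, hS, hg, w₀, hw₀, h₀⟩
    have hloc : ∀ w, 2 ≤ deg M w → ∀ b,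
        (graph (trunc N d t)).Adj (g w) b ↔ (graph t).Adj (g w) b := by
      intro w hw b
      obtain ⟨a, ha, he, hl⟩ := explored_of_central hM hN g hg hw₀ h₀ hw
      rw [ha]
      exact graph_trunc_adj_of_explored he (by omega) b
    refine IsCentral.congr g hS hg hw₀ h₀ hloc fun v w => ?_
    constructor
    · exact Or.imp Edge.of_trunc Edge.of_trunc
    · intro h
      rcases hpair v w (g.map_rel_iff.1 h) with hv | hw
      · exact (hloc v hv _).2 h
      · exact ((hloc w hw _).2 h.symm).symm

theorem centralCount_trunc (hM : M.Connected) (hcard : 3 ≤ Fintype.card W) {N d : ℕ}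
    (hN : Fintype.card W ≤ N) (hd : Fintype.card W ≤ d) (t : PlaneTree) :
    centralCount M (trunc N d t) = centralCount M t := by
  rw [centralCount, centralCount]
  congr 1
  ext S
  exact isCentral_trunc hM hcard hN hd t S

theorem centralCount_eq_zero {N : ℕ} (hN : Fintype.card W ≤ N) {k : ℕ} (f : Fin k → PlaneTree)
    (hk : ¬ (1 ≤ k ∧ k ≤ N)) : centralCount M (node k f) = 0 := by
  have : {S | IsCentral M (node k f) S} = ∅ := by
    refine Set.eq_empty_iff_forall_notMem.2 ?_
    rintro S ⟨g, -, hg, w₀, hw₀, h₀⟩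
    exact hk (explored_nil hN g hg hw₀ h₀)
  rw [centralCount, this, Set.ncard_empty]

end PlaneTree

/-! ### Power series with non-negative coefficients -/

section NonnegCoeffs

variable {σ : Type*}

/-- All coefficients are non-negative. -/
def NonnegCoeffs (f : MvPowerSeries σ ℝ) : Prop := ∀ e, 0 ≤ MvPowerSeries.coeff e f

theorem NonnegCoeffs.mul {f g : MvPowerSeries σ ℝ} (hf : NonnegCoeffs f) (hg : NonnegCoeffs g) :
    NonnegCoeffs (f * g) := fun e => by
  classical
  rw [MvPowerSeries.coeff_mul]
  exact Finset.sum_nonneg fun p _ => mul_nonneg (hf _) (hg _)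

theorem NonnegCoeffs.sum {ι : Type*} {s : Finset ι} {f : ι → MvPowerSeries σ ℝ}
    (h : ∀ i ∈ s, NonnegCoeffs (f i)) : NonnegCoeffs (∑ i ∈ s, f i) := fun e => by
  rw [map_sum]
  exact Finset.sum_nonneg fun i hi => h i hi e

theorem NonnegCoeffs.smul {f : MvPowerSeries σ ℝ} (hf : NonnegCoeffs f) {r : ℝ} (hr : 0 ≤ r) :
    NonnegCoeffs (r • f) := fun e => by
  rw [map_smul]
  exact mul_nonneg hr (hf e)

theorem NonnegCoeffs.one : NonnegCoeffs (1 : MvPowerSeries σ ℝ) := fun e => by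
  classical
  rw [MvPowerSeries.coeff_one]
  split_ifs <;> norm_num

theorem NonnegCoeffs.X (s : σ) : NonnegCoeffs (MvPowerSeries.X s : MvPowerSeries σ ℝ) :=
  fun e => by
    classical
    rw [MvPowerSeries.coeff_X]
    split_ifs <;> norm_num

theorem NonnegCoeffs.prod {ι : Type*} {s : Finset ι} {f : ι → MvPowerSeries σ ℝ}
    (h : ∀ i ∈ s, NonnegCoeffs (f i)) : NonnegCoeffs (∏ i ∈ s, f i) :=
  Finset.prod_induction f NonnegCoeffs (fun _ _ => NonnegCoeffs.mul) NonnegCoeffs.one h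

theorem NonnegCoeffs.pow {f : MvPowerSeries σ ℝ} (hf : NonnegCoeffs f) (n : ℕ) :
    NonnegCoeffs (f ^ n) := by
  rw [← Fin.prod_const]
  exact NonnegCoeffs.prod fun _ _ => hf

theorem coeff_mul_pos {f g : MvPowerSeries σ ℝ} (hf : NonnegCoeffs f) (hg : NonnegCoeffs g)
    {a b : σ →₀ ℕ} (ha : 0 < MvPowerSeries.coeff a f) (hb : 0 < MvPowerSeries.coeff b g) :
    0 < MvPowerSeries.coeff (a + b) (f * g) := by
  classical
  rw [MvPowerSeries.coeff_mul]
  exact Finset.sum_pos' (fun p _ => mul_nonneg (hf _) (hg _))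
    ⟨(a, b), Finset.HasAntidiagonal.mem_antidiagonal.2 rfl, mul_pos ha hb⟩

theorem coeff_prod_pos {ι : Type*} {s : Finset ι} {f : ι → MvPowerSeries σ ℝ}
    (h : ∀ i ∈ s, NonnegCoeffs (f i)) {a : ι → σ →₀ ℕ}
    (ha : ∀ i ∈ s, 0 < MvPowerSeries.coeff (a i) (f i)) :
    0 < MvPowerSeries.coeff (∑ i ∈ s, a i) (∏ i ∈ s, f i) := by
  classical
  induction s using Finset.induction_on with
  | empty => simp
  | insert i s hi ih =>
    rw [Finset.sum_insert hi, Finset.prod_insert hi]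
    exact coeff_mul_pos (h i (by simp)) (NonnegCoeffs.prod fun j hj => h j (by simp [hj]))
      (ha i (by simp)) (ih (fun j hj => h j (by simp [hj])) (fun j hj => ha j (by simp [hj])))

theorem coeff_pow_pos {f : MvPowerSeries σ ℝ} (hf : NonnegCoeffs f) {a : σ →₀ ℕ}
    (ha : 0 < MvPowerSeries.coeff a f) (n : ℕ) : 0 < MvPowerSeries.coeff (n • a) (f ^ n) := by
  have := coeff_prod_pos (s := (Finset.univ : Finset (Fin n))) (f := fun _ => f) (a := fun _ => a)
    (fun _ _ => hf) (fun _ _ => ha)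
  simpa using this

theorem coeff_sum_pos {ι : Type*} {s : Finset ι} {f : ι → MvPowerSeries σ ℝ}
    (h : ∀ i ∈ s, NonnegCoeffs (f i)) {e : σ →₀ ℕ} {i : ι} (hi : i ∈ s)
    (hpos : 0 < MvPowerSeries.coeff e (f i)) : 0 < MvPowerSeries.coeff e (∑ i ∈ s, f i) := by
  rw [map_sum]
  exact Finset.sum_pos' (fun j hj => h j hj e) ⟨i, hi, hpos⟩

/-- The coefficients of `exp f` are given by a finite part of the exponential series. -/
theorem coeff_expSeries {f : MvPowerSeries σ ℝ} (hf : MvPowerSeries.constantCoeff f = 0)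
    {e : σ →₀ ℕ} {n : ℕ} (hn : e.degree ≤ n) :
    MvPowerSeries.coeff e (expSeries f) =
      ∑ k ∈ Finset.range (n + 1), (k ! : ℝ)⁻¹ * MvPowerSeries.coeff e (f ^ k) := by
  rw [expSeries, PowerSeries.coeff_subst (PowerSeries.HasSubst.of_constantCoeff_zero hf),
    finsum_eq_sum_of_support_subset (s := Finset.range (n + 1))]
  · refine Finset.sum_congr rfl fun k _ => ?_
    simp [PowerSeries.coeff_exp]
  · intro k hk
    by_contra hkn
    refine hk ?_
    simp only [Finset.coe_range, Set.mem_Iio, not_lt] at hkn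
    change _ • MvPowerSeries.coeff e (f ^ k) = 0
    rw [MvPowerSeries.coeff_eq_zero_of_constantCoeff_nilpotent (m := 1) (by simpa using hf)
      (by omega), smul_zero]

/-- Removing the terms of order `1` to `N` leaves a sum without any subtraction. Both the
coefficientwise bound and the edges out of class `0` rest on this form. -/
theorem coeff_sub_expSeries {f : MvPowerSeries σ ℝ} (hf : MvPowerSeries.constantCoeff f = 0)
    {e : σ →₀ ℕ} {n N : ℕ} (hn : e.degree ≤ n) (hN : N ≤ n) :
    MvPowerSeries.coeff e (expSeries f - ∑ k ∈ Finset.Icc 1 N, (k ! : ℝ)⁻¹ • f ^ k) =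
      ∑ k ∈ Finset.range (n + 1) \ Finset.Icc 1 N,
        (k ! : ℝ)⁻¹ * MvPowerSeries.coeff e (f ^ k) := by
  have hsub : Finset.Icc 1 N ⊆ Finset.range (n + 1) := fun k hk => by
    simp only [Finset.mem_Icc, Finset.mem_range] at hk ⊢
    omega
  rw [map_sub, coeff_expSeries hf hn, map_sum, ← Finset.sum_sdiff hsub]
  simp

end NonnegCoeffs

/-! ### Generating functions of weighted families -/

section Gf

variable {σ X Y : Type*}

/-- The generating function of a family of objects of sizes `sz` and weights `w`. -/
def gf (sz : X → σ →₀ ℕ) (w : X → ℝ) : MvPowerSeries σ ℝ :=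
  fun e => ∑ᶠ (x) (_ : sz x = e), w x

/-- There are only finitely many objects of each size. -/
def FiniteFibers (sz : X → σ →₀ ℕ) : Prop := ∀ e, {x | sz x = e}.Finite

theorem coeff_gf (sz : X → σ →₀ ℕ) (w : X → ℝ) (e : σ →₀ ℕ) :
    MvPowerSeries.coeff e (gf sz w) = ∑ᶠ (x) (_ : sz x = e), w x := rfl

theorem coeff_gf_eq_sum [DecidableEq (σ →₀ ℕ)] {sz : X → σ →₀ ℕ} {w : X → ℝ} {e : σ →₀ ℕ}
    {s : Finset X} (hs : ∀ x, sz x = e → x ∈ s) :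
    MvPowerSeries.coeff e (gf sz w) = ∑ x ∈ s with sz x = e, w x := by
  rw [coeff_gf]
  refine finsum_mem_eq_sum_of_inter_support_eq w (s := {x | sz x = e}) ?_
  ext x
  simp only [Finset.coe_filter, Set.mem_inter_iff, Set.mem_ofPred_eq]
  exact ⟨fun h => ⟨⟨hs x h.1, h.1⟩, h.2⟩, fun h => ⟨h.1.2, h.2⟩⟩

theorem gf_congr {sz sz' : X → σ →₀ ℕ} {w w' : X → ℝ} (hw : ∀ x, w x = w' x)
    (h : ∀ x, w x ≠ 0 → sz x = sz' x) : gf sz w = gf sz' w' := by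
  ext e
  rw [coeff_gf, coeff_gf]
  refine finsum_congr fun x => ?_
  rw [← hw x]
  by_cases hx : w x = 0
  · simp [hx]
  · rw [h x hx]

theorem gf_equiv (ψ : Y ≃ X) (sz : X → σ →₀ ℕ) (w : X → ℝ) :
    gf (fun y => sz (ψ y)) (fun y => w (ψ y)) = gf sz w := by
  ext e
  rw [coeff_gf, coeff_gf]
  exact finsum_comp_equiv ψ (f := fun x => ∑ᶠ (_ : sz x = e), w x)

theorem gf_smul {sz : X → σ →₀ ℕ} (hsz : FiniteFibers sz) (r : ℝ) (w : X → ℝ) :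
    gf sz (fun x => r * w x) = r • gf sz w := by
  classical
  ext e
  rw [map_smul, coeff_gf_eq_sum (s := (hsz e).toFinset) (by simp),
    coeff_gf_eq_sum (s := (hsz e).toFinset) (by simp), smul_eq_mul, Finset.mul_sum]

theorem gf_sum {sz : X → σ →₀ ℕ} (hsz : FiniteFibers sz) {ι : Type*} (s : Finset ι)
    (w : ι → X → ℝ) : gf sz (fun x => ∑ i ∈ s, w i x) = ∑ i ∈ s, gf sz (w i) := by
  classical
  ext e
  rw [map_sum, coeff_gf_eq_sum (s := (hsz e).toFinset) (by simp), Finset.sum_comm]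
  refine Finset.sum_congr rfl fun i _ => ?_
  rw [coeff_gf_eq_sum (s := (hsz e).toFinset) (by simp)]

theorem FiniteFibers.finite_le {sz : X → σ →₀ ℕ} (h : FiniteFibers sz) (e : σ →₀ ℕ) :
    {x | sz x ≤ e}.Finite := by
  classical
  refine ((Set.finite_Iic e).biUnion fun e' _ => h e').subset fun x hx => ?_
  exact Set.mem_biUnion (Set.mem_Iic.2 hx) rfl

theorem gf_mul {sz : X → σ →₀ ℕ} {sz' : Y → σ →₀ ℕ} (h : FiniteFibers sz)
    (h' : FiniteFibers sz') (w : X → ℝ) (w' : Y → ℝ) :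
    gf sz w * gf sz' w' = gf (fun p : X × Y => sz p.1 + sz' p.2) (fun p => w p.1 * w' p.2) := by
  classical
  ext e
  set s := (h.finite_le e).toFinset with hs
  set s' := (h'.finite_le e).toFinset with hs'
  rw [MvPowerSeries.coeff_mul, coeff_gf_eq_sum (s := s ×ˢ s'),
    ← Finset.sum_fiberwise_of_maps_to (t := Finset.HasAntidiagonal.antidiagonal e)
      (g := fun p : X × Y => (sz p.1, sz' p.2))]
  · refine Finset.sum_congr rfl fun p hp => ?_
    rw [Finset.HasAntidiagonal.mem_antidiagonal] at hp
    rw [coeff_gf_eq_sum (s := s), coeff_gf_eq_sum (s := s'), Finset.sum_mul_sum,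
      ← Finset.sum_product']
    · refine Finset.sum_congr ?_ fun _ _ => rfl
      ext q
      simp only [Finset.mem_product, Finset.mem_filter, Prod.ext_iff]
      constructor
      · rintro ⟨⟨h1, h2⟩, h3, h4⟩
        exact ⟨⟨⟨h1, h3⟩, by rw [h2, h4, hp]⟩, h2, h4⟩
      · rintro ⟨⟨⟨h1, h3⟩, -⟩, h2, h4⟩
        exact ⟨⟨h1, h2⟩, h3, h4⟩
    · intro y hy
      rw [hs', Set.Finite.mem_toFinset, Set.mem_ofPred_eq, hy, ← hp]
      exact le_add_self
    · intro y hy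
      rw [hs, Set.Finite.mem_toFinset, Set.mem_ofPred_eq, hy, ← hp]
      exact le_self_add
  · intro p hp
    simpa using (Finset.mem_filter.1 hp).2
  · intro p hp
    rw [Finset.mem_product, hs, hs', Set.Finite.mem_toFinset, Set.Finite.mem_toFinset, ← hp]
    exact ⟨(le_self_add : sz p.1 ≤ sz p.1 + sz' p.2), (le_add_self : sz' p.2 ≤ sz p.1 + sz' p.2)⟩

theorem FiniteFibers.pi {sz : X → σ →₀ ℕ} (h : FiniteFibers sz) (k : ℕ) :
    FiniteFibers fun f : Fin k → X => ∑ i, sz (f i) := fun e => by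
  refine (Set.Finite.pi' fun _ : Fin k => h.finite_le e).subset fun f hf i => ?_
  rw [Set.mem_ofPred_eq, ← (hf : ∑ i, sz (f i) = e)]
  exact Finset.single_le_sum (f := fun i => sz (f i)) (fun _ _ => zero_le) (Finset.mem_univ i)

theorem gf_pi {sz : X → σ →₀ ℕ} (h : FiniteFibers sz) (k : ℕ) (w : Fin k → X → ℝ) :
    ∏ i, gf sz (w i) =
      gf (fun f : Fin k → X => ∑ i, sz (f i)) (fun f => ∏ i, w i (f i)) := by
  classical
  induction k with
  | zero =>
    ext e
    rw [coeff_gf_eq_sum (s := {Fin.elim0}) (fun x _ => by simp [Subsingleton.elim x Fin.elim0])]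
    rw [Finset.sum_filter]
    simp [MvPowerSeries.coeff_one, eq_comm]
  | succ k ih =>
    rw [Fin.prod_univ_succ, ih, gf_mul h (h.pi k), ← gf_equiv (Fin.consEquiv fun _ => X)]
    refine gf_congr (fun p => ?_) (fun p _ => ?_)
    · simp [Fin.prod_univ_succ, Fin.consEquiv]
    · simp [Fin.sum_univ_succ, Fin.consEquiv]

theorem monomial_mul_gf (a : σ →₀ ℕ) (sz : X → σ →₀ ℕ) (h : FiniteFibers sz) (w : X → ℝ) :
    MvPowerSeries.monomial a 1 * gf sz w = gf (fun x => a + sz x) w := by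
  classical
  have h1 : MvPowerSeries.monomial a (1 : ℝ) = gf (fun _ : Unit => a) (fun _ => 1) := by
    ext e
    rw [coeff_gf_eq_sum (s := {()}) (fun x _ => by simp)]
    rw [Finset.sum_filter]
    simp [MvPowerSeries.coeff_monomial, eq_comm]
  rw [h1, gf_mul (fun e => Set.toFinite _) h, ← gf_equiv (Equiv.punitProd X).symm]
  exact gf_congr (fun p => by simp) (fun p _ => by simp)

end Gf

/-! ### The generating function of weighted plane trees -/

namespace PlaneTree

/-- The inverse of the number of ways to reorder the children of all nodes. -/
def wt : PlaneTree → ℝ≥0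
  | node k f => (k ! : ℝ≥0)⁻¹ * ∏ i, wt (f i)

theorem size_pos (t : PlaneTree) : 1 ≤ size t := by
  cases t
  rw [size]
  omega

theorem arity_lt_size (t : PlaneTree) : arity t < size t := by
  cases t with
  | node k f =>
    rw [size, arity]
    have := Finset.sum_le_sum (s := Finset.univ) fun (i : Fin k) _ => size_pos (f i)
    simp at this
    omega

theorem node_injective (k : ℕ) : Function.Injective (node k) := fun f g h => by
  injection h

theorem finite_size_le (n : ℕ) : {t | size t ≤ n}.Finite := by
  induction n with
  | zero =>
    refine Set.Finite.subset Set.finite_empty fun t ht => ?_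
    have h1 := size_pos t
    have h2 : size t ≤ 0 := ht
    omega
  | succ n ih =>
    refine Set.Finite.subset ((Set.finite_Iic n).biUnion fun k _ =>
      (Set.Finite.pi' fun _ : Fin k => ih).image (node k)) ?_
    rintro ⟨k, f⟩ ht
    have h1 : size (node k f) ≤ n + 1 := ht
    have h2 := arity_lt_size (node k f)
    rw [arity] at h2
    refine Set.mem_biUnion (x := k) (Set.mem_Iic.2 (by omega)) ⟨f, fun i => ?_, rfl⟩
    rw [size] at h1
    have := Finset.single_le_sum (f := fun i => size (f i)) (fun _ _ => Nat.zero_le _)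
      (Finset.mem_univ i)
    exact (show size (f i) ≤ n by omega)

theorem finiteFibers_of_size {sz : PlaneTree → Fin 2 →₀ ℕ} (h : ∀ t, sz t 0 = size t) :
    FiniteFibers sz := fun e => by
  refine (finite_size_le (e 0)).subset fun t ht => ?_
  have ht' : sz t = e := ht
  exact (show size t ≤ e 0 by rw [← ht', h])

/-- The exponents of `x` and `u` that belong to a plane tree. -/
def bisize (occ : PlaneTree → ℕ) (t : PlaneTree) : Fin 2 →₀ ℕ :=
  Finsupp.single 0 (size t) + Finsupp.single 1 (occ t)

/-- The exponents when only the occurrences in the subtrees of the root are counted. -/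
def preBisize (occ : PlaneTree → ℕ) : PlaneTree → Fin 2 →₀ ℕ
  | node _ f => Finsupp.single 0 1 + ∑ i, bisize occ (f i)

theorem bisize_zero (occ : PlaneTree → ℕ) (t : PlaneTree) : bisize occ t 0 = size t := by
  simp [bisize]

theorem preBisize_zero (occ : PlaneTree → ℕ) (t : PlaneTree) : preBisize occ t 0 = size t := by
  cases t
  simp [preBisize, bisize_zero, size]

theorem bisize_node {occ cen : PlaneTree → ℕ}
    (hocc : ∀ k f, occ (node k f) = ∑ i, occ (f i) + cen (node k f)) (t : PlaneTree) :
    bisize occ t = Finsupp.single 1 (cen t) + preBisize occ t := by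
  cases t with
  | node k f =>
    simp only [bisize, preBisize, size, hocc, Finsupp.single_add, Finset.sum_add_distrib,
      Finsupp.single_finsetSum]
    abel

theorem finiteFibers_bisize (occ : PlaneTree → ℕ) : FiniteFibers (bisize occ) :=
  finiteFibers_of_size (bisize_zero occ)

theorem finiteFibers_preBisize (occ : PlaneTree → ℕ) : FiniteFibers (preBisize occ) :=
  finiteFibers_of_size (preBisize_zero occ)

theorem gf_arity {σ : Type*} (sz : PlaneTree → σ →₀ ℕ) (w : PlaneTree → ℝ) (k : ℕ) :
    gf sz (fun t => if arity t = k then w t else 0) =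
      gf (fun f : Fin k → PlaneTree => sz (node k f)) (fun f => w (node k f)) := by
  ext e
  rw [coeff_gf, coeff_gf]
  set F : PlaneTree → ℝ := fun t => ∑ᶠ (_ : sz t = e), if arity t = k then w t else 0 with hF
  have h1 : ∀ f : Fin k → PlaneTree, (∑ᶠ (_ : sz (node k f) = e), w (node k f)) = F (node k f) :=
    fun f => by simp [hF, arity]
  simp_rw [h1]
  rw [← finsum_mem_range (f := F) (node_injective k), ← finsum_mem_univ]
  refine finsum_mem_inter_support_eq' _ _ _ fun t ht => ?_
  simp only [Set.mem_univ, true_iff]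
  cases t with
  | node l f =>
    by_cases hl : l = k
    · subst hl
      exact ⟨f, rfl⟩
    · exact absurd (by simp [arity, hl]) ht

/-- The generating function of the plane trees whose root has `k` children. -/
theorem gf_preBisize_arity (occ : PlaneTree → ℕ) (k : ℕ) :
    gf (preBisize occ) (fun t => if arity t = k then (wt t : ℝ) else 0) =
      varX * ((k ! : ℝ)⁻¹ • (gf (bisize occ) fun t => (wt t : ℝ)) ^ k) := by
  have hf := finiteFibers_bisize occ
  rw [gf_arity, ← Fin.prod_const, gf_pi hf, ← gf_smul (hf.pi k), varX, MvPowerSeries.X,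
    monomial_mul_gf _ _ (hf.pi k)]
  exact gf_congr (fun f => by simp [wt]) fun f _ => rfl

theorem constantCoeff_gf_bisize (occ : PlaneTree → ℕ) (w : PlaneTree → ℝ) :
    MvPowerSeries.constantCoeff (gf (bisize occ) w) = 0 := by
  classical
  rw [← MvPowerSeries.coeff_zero_eq_constantCoeff_apply, coeff_gf_eq_sum (s := ∅)]
  · simp
  · intro t ht
    have h1 := bisize_zero occ t
    rw [ht] at h1
    have := size_pos t
    simp at h1
    omega

/-- The arity of the root is less than the size, so each coefficient receives contributions from
finitely many arities, and these match the finitely many relevant terms of the exponential. -/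
theorem gf_preBisize (occ : PlaneTree → ℕ) :
    gf (preBisize occ) (fun t => (wt t : ℝ)) =
      varX * expSeries (gf (bisize occ) fun t => (wt t : ℝ)) := by
  classical
  ext e
  have h1 : MvPowerSeries.coeff e (gf (preBisize occ) (fun t => (wt t : ℝ))) =
      MvPowerSeries.coeff e (gf (preBisize occ) (fun t => ∑ k ∈ Finset.range (e.degree + 1),
        if arity t = k then (wt t : ℝ) else 0)) := by
    rw [coeff_gf, coeff_gf]
    refine finsum_congr fun t => finsum_congr_Prop rfl fun ht => ?_
    have h2 := arity_lt_size t
    rw [← preBisize_zero occ, ht] at h2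
    have h3 := Finsupp.le_degree 0 e
    rw [Finset.sum_ite_eq, if_pos (by rw [Finset.mem_range]; omega)]
  rw [h1, gf_sum (finiteFibers_preBisize occ), map_sum, varX, MvPowerSeries.X,
    MvPowerSeries.coeff_monomial_mul]
  simp_rw [gf_preBisize_arity, varX, MvPowerSeries.X, MvPowerSeries.coeff_monomial_mul]
  split_ifs with h
  · rw [coeff_expSeries (constantCoeff_gf_bisize occ _) (n := e.degree)]
    · simp
    · exact Finsupp.degree_mono (tsub_le_self)
  · simp

end PlaneTree

/-! ### The system of equations attached to a classification -/

open PlaneTree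

/-- A partition of the plane trees into `L + 1` classes, with a representative of each class,
that determines the number `cen` and is compatible with grafting. -/
structure Classification (cen : PlaneTree → ℕ) (N L : ℕ) where
  cls : PlaneTree → Fin (L + 1)
  rep : Fin (L + 1) → PlaneTree
  cls_rep : ∀ i, cls (rep i) = i
  cls_eq_zero : ∀ t, cls t = 0 ↔ ¬ (1 ≤ arity t ∧ arity t ≤ N)
  cls_node : ∀ k f, cls (node k fun i => rep (cls (f i))) = cls (node k f)
  cen_rep : ∀ t, cen (rep (cls t)) = cen t
  rep_subtree : ∀ i k f, rep i = node k f → ∀ j, rep (cls (f j)) = f j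

namespace Classification

variable {cen occ : PlaneTree → ℕ} {N L : ℕ} (C : Classification cen N L)

/-- The class of the trees with root degree `k` and subtrees from the classes `g i`. -/
def graft (k : ℕ) (g : Fin k → Fin (L + 1)) : Fin (L + 1) := C.cls (node k fun i => C.rep (g i))

/-- The generating function of a class. -/
def series (occ : PlaneTree → ℕ) (i : Fin (L + 1)) : SeriesXU :=
  gf (bisize occ) fun t => if C.cls t = i then (wt t : ℝ) else 0

/-- The polynomials on the right-hand sides of the system. -/
def poly (j : Fin L) : PolyYU L :=
  ∑ k ∈ Finset.Icc 1 N, ∑ g : Fin k → Fin (L + 1), if C.graft k g = j.succ then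
    (k ! : ℝ)⁻¹ • (MvPolynomial.X none ^ cen (C.rep j.succ) *
      ∏ i, MvPolynomial.X (some (g i))) else 0

theorem evalAt_poly {A : Type*} [CommRing A] [Algebra ℝ A] (b : Fin (L + 1) → A) (v : A)
    (j : Fin L) : (C.poly j).evalAt b v =
      ∑ k ∈ Finset.Icc 1 N, ∑ g : Fin k → Fin (L + 1), if C.graft k g = j.succ then
        (k ! : ℝ)⁻¹ • (v ^ cen (C.rep j.succ) * ∏ i, b (g i)) else 0 := by
  rw [PolyYU.evalAt, poly, map_sum]
  refine Finset.sum_congr rfl fun k _ => ?_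
  rw [map_sum]
  refine Finset.sum_congr rfl fun g _ => ?_
  split_ifs
  · simp
  · simp

theorem graft_ne_zero {k : ℕ} (hk : k ∈ Finset.Icc 1 N) (g : Fin k → Fin (L + 1)) :
    C.graft k g ≠ 0 := by
  rw [Ne, graft, C.cls_eq_zero, not_not, arity]
  exact Finset.mem_Icc.1 hk

/-- Each `k`-tuple of classes with `1 ≤ k ≤ N` grafts to exactly one class, and never to class `0`.
With `u = 1` the sum over `j` thus runs over all tuples, which is the expansion of the `k`-th power.
-/
theorem sum_evalAt_poly_one {A : Type*} [CommRing A] [Algebra ℝ A] (b : Fin (L + 1) → A) :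
    ∑ j, (C.poly j).evalAt b 1 = ∑ k ∈ Finset.Icc 1 N, (k ! : ℝ)⁻¹ • (∑ i, b i) ^ k := by
  simp_rw [evalAt_poly]
  rw [Finset.sum_comm]
  refine Finset.sum_congr rfl fun k hk => ?_
  rw [Finset.sum_comm, Fintype.sum_pow, Finset.smul_sum]
  refine Finset.sum_congr rfl fun g _ => ?_
  obtain ⟨j, hj⟩ := Fin.exists_succ_eq.2 (C.graft_ne_zero hk g)
  rw [Finset.sum_eq_single j]
  · simp [hj]
  · intro j' _ hjj
    rw [if_neg]
    rw [← hj]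
    exact fun h => hjj (Fin.succ_injective _ h).symm
  · simp

theorem sum_series : ∑ i, C.series occ i = gf (bisize occ) fun t => (wt t : ℝ) := by
  simp_rw [series]
  rw [← gf_sum (finiteFibers_bisize occ)]
  exact gf_congr (fun t => by simp) fun _ _ => rfl

theorem constantCoeff_series (i : Fin (L + 1)) :
    MvPowerSeries.constantCoeff (C.series occ i) = 0 :=
  constantCoeff_gf_bisize occ _

variable (hocc : ∀ k f, occ (node k f) = ∑ i, occ (f i) + cen (node k f))
include hocc

/-- Trees of class `0` have no central occurrence, so counting the occurrences in the branches
counts all of them. The other trees are those of arity `1` to `N`, whose contribution is subtracted.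
-/
theorem series_zero (hcen : ∀ t, ¬ (1 ≤ arity t ∧ arity t ≤ N) → cen t = 0) :
    C.series occ 0 = varX * expSeries (∑ i, C.series occ i) -
      varX * ∑ j, (C.poly j).evalAt (C.series occ) 1 := by
  rw [C.sum_evalAt_poly_one, C.sum_series, ← gf_preBisize, Finset.mul_sum, eq_sub_iff_add_eq]
  simp_rw [← gf_preBisize_arity]
  have h0 : C.series occ 0 =
      gf (preBisize occ) fun t => if C.cls t = 0 then (wt t : ℝ) else 0 := by
    refine gf_congr (fun _ => rfl) fun t ht => ?_
    rw [bisize_node hocc, hcen t ((C.cls_eq_zero t).1 ?_), Finsupp.single_zero, zero_add]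
    by_contra h
    exact ht (if_neg h)
  rw [h0, ← gf_sum (finiteFibers_preBisize occ)]
  -- Indexing by `Bool` turns `gf_sum` into additivity for two series.
  have hadd := gf_sum (finiteFibers_preBisize occ) (Finset.univ : Finset Bool)
    (fun b t => if b then (if C.cls t = 0 then (wt t : ℝ) else 0) else
      ∑ k ∈ Finset.Icc 1 N, if arity t = k then (wt t : ℝ) else 0)
  simp only [Fintype.sum_bool] at hadd
  simp only [if_true, Bool.false_eq_true, if_false] at hadd
  rw [← hadd]
  refine gf_congr (fun t => ?_) fun _ _ => rfl
  rw [Finset.sum_ite_eq]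
  have := C.cls_eq_zero t
  by_cases h : C.cls t = 0
  · simp [h, Finset.mem_Icc, this.1 h]
  · rw [if_neg h, if_pos, zero_add]
    rw [this, not_not] at h
    exact Finset.mem_Icc.2 h

theorem gf_arity_succ (j : Fin L) (k : ℕ) :
    gf (bisize occ) (fun t => if arity t = k then
        (if C.cls t = j.succ then (wt t : ℝ) else 0) else 0) =
      varX * ∑ g : Fin k → Fin (L + 1), if C.graft k g = j.succ then
        (k ! : ℝ)⁻¹ • (varU ^ cen (C.rep j.succ) * ∏ i, C.series occ (g i)) else 0 := by
  have hf := finiteFibers_bisize occ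
  have hmon : (MvPowerSeries.monomial (Finsupp.single 0 1 +
      Finsupp.single 1 (cen (C.rep j.succ))) 1 : SeriesXU) =
      varX * varU ^ cen (C.rep j.succ) := by
    rw [varX, varU, MvPowerSeries.X_pow_eq, MvPowerSeries.X, MvPowerSeries.monomial_mul_monomial,
      one_mul]
  -- Only the tuple `g` of the actual classes of the branches contributes; for any other tuple some
  -- factor vanishes.
  have h1 : ∀ f : Fin k → PlaneTree, (if C.cls (node k f) = j.succ then (wt (node k f) : ℝ) else 0) =
      ∑ g : Fin k → Fin (L + 1), if C.graft k g = j.succ then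
        (k ! : ℝ)⁻¹ * ∏ i, (if C.cls (f i) = g i then (wt (f i) : ℝ) else 0) else 0 := by
    intro f
    rw [Finset.sum_eq_single fun i => C.cls (f i)]
    · rw [graft, C.cls_node]
      simp [wt]
    · intro g _ hg
      obtain ⟨i, hi⟩ := Function.ne_iff.1 hg
      rw [Finset.prod_eq_zero (Finset.mem_univ i) (if_neg (Ne.symm hi)), mul_zero, ite_self]
    · simp
  rw [gf_arity]
  rw [gf_congr (sz' := fun f : Fin k → PlaneTree => (Finsupp.single 0 1 +
      Finsupp.single 1 (cen (C.rep j.succ))) + ∑ i, bisize occ (f i)) h1, ← monomial_mul_gf _ _ (hf.pi k),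
    hmon, gf_sum (hf.pi k), mul_assoc]
  · congr 1
    rw [Finset.mul_sum]
    refine Finset.sum_congr rfl fun g _ => ?_
    split_ifs
    · rw [gf_smul (hf.pi k), mul_smul_comm]
      congr 2
      rw [← gf_pi hf k fun i t => if C.cls t = g i then (wt t : ℝ) else 0]
      rfl
    · have := gf_smul (hf.pi k) 0 0
      simp only [zero_mul, zero_smul] at this
      rw [this, mul_zero]
  · intro f h
    have hj : C.cls (node k f) = j.succ := by
      by_contra hj
      exact h (if_neg hj)
    rw [bisize_node hocc, ← hj, C.cen_rep, preBisize]
    abel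

theorem series_succ (j : Fin L) :
    C.series occ j.succ = varX * (C.poly j).evalAt (C.series occ) varU := by
  have h0 : C.series occ j.succ = gf (bisize occ)
      fun t => ∑ k ∈ Finset.Icc 1 N, if arity t = k then
        (if C.cls t = j.succ then (wt t : ℝ) else 0) else 0 := by
    refine gf_congr (fun t => ?_) fun _ _ => rfl
    rw [Finset.sum_ite_eq]
    split_ifs with h1 h2
    · rfl
    · rw [Finset.mem_Icc, ← C.cls_eq_zero, h1] at h2
      exact absurd h2 (Fin.succ_ne_zero j)
    · rfl
    · rfl
  rw [h0, gf_sum (finiteFibers_bisize occ), C.evalAt_poly, Finset.mul_sum]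
  exact Finset.sum_congr rfl fun k _ => C.gf_arity_succ hocc j k

omit hocc

theorem coeff_poly_nonneg (j : Fin L) (e) : 0 ≤ MvPolynomial.coeff e (C.poly j) := by
  have hX : ∀ s, NonnegCoeffs
      (MvPolynomial.coeToMvPowerSeries.ringHom (MvPolynomial.X s : PolyYU L)) := fun s => by
    rw [MvPolynomial.coeToMvPowerSeries.ringHom_apply, MvPolynomial.coe_X]
    exact NonnegCoeffs.X s
  rw [← MvPolynomial.coeff_coe, poly, ← MvPolynomial.coeToMvPowerSeries.ringHom_apply, map_sum]
  refine NonnegCoeffs.sum (fun k _ => ?_) e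
  rw [map_sum]
  refine NonnegCoeffs.sum fun g _ => ?_
  split_ifs
  · rw [MvPolynomial.smul_eq_C_mul, map_mul, map_mul, map_prod, map_pow]
    have hC : MvPolynomial.coeToMvPowerSeries.ringHom (MvPolynomial.C (k ! : ℝ)⁻¹ : PolyYU L) =
        MvPowerSeries.C (k ! : ℝ)⁻¹ := by
      rw [MvPolynomial.coeToMvPowerSeries.ringHom_apply, MvPolynomial.coe_C]
    rw [hC, ← MvPowerSeries.smul_eq_C_mul]
    exact (((hX _).pow _).mul (NonnegCoeffs.prod fun i _ => hX _)).smul (by positivity)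
  · rw [map_zero]
    intro e
    simp

theorem constantCoeff_sum_X {σ ι : Type*} (s : Finset ι) (y : ι → σ) :
    MvPowerSeries.constantCoeff (∑ i ∈ s, (MvPowerSeries.X (y i) : MvPowerSeries σ ℝ)) = 0 := by
  simp

theorem nonnegCoeffs_sum_X {σ ι : Type*} (s : Finset ι) (y : ι → σ) :
    NonnegCoeffs (∑ i ∈ s, (MvPowerSeries.X (y i) : MvPowerSeries σ ℝ)) :=
  NonnegCoeffs.sum fun _ _ => NonnegCoeffs.X _

theorem coeffLE : CoeffLE
    (∑ j, (C.poly j).evalAt (fun i : Fin (L + 1) => (MvPowerSeries.X i : MvPowerSeries _ ℝ)) 1)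
    (expSeries (∑ i : Fin (L + 1), MvPowerSeries.X i)) := by
  intro e
  rw [← sub_nonneg, ← map_sub, C.sum_evalAt_poly_one,
    coeff_sub_expSeries (constantCoeff_sum_X _ fun i => i) (le_max_left e.degree N)
      (le_max_right e.degree N)]
  exact Finset.sum_nonneg fun k _ => mul_nonneg (by positivity)
    ((nonnegCoeffs_sum_X _ fun i => i).pow k e)

/-- The witness is the monomial `x * y_i ^ (N + 1)`. It occurs in the exponential, while the
subtracted part has degree at most `N` in the `y` variables. -/
theorem depEdge_zero (i : Fin (L + 1)) : DepEdge (rhs C.poly) 0 i := by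
  classical
  set s : MvPowerSeries (SysVar L) ℝ := ∑ i, MvPowerSeries.X (SysVar.y i) with hs
  have hrhs : rhs C.poly 0 =
      MvPowerSeries.X SysVar.x * (expSeries s - ∑ k ∈ Finset.Icc 1 N, (k ! : ℝ)⁻¹ • s ^ k) := by
    rw [rhs, Fin.cons_zero, C.sum_evalAt_poly_one, mul_sub]
  have hnn : NonnegCoeffs s := nonnegCoeffs_sum_X _ _
  set a : SysVar L →₀ ℕ := Finsupp.single (SysVar.y i) 1 with ha
  have hpos : 0 < MvPowerSeries.coeff a s := by
    refine coeff_sum_pos (fun _ _ => NonnegCoeffs.X _) (Finset.mem_univ i) ?_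
    simp [ha, MvPowerSeries.coeff_X]
  refine ⟨Finsupp.single SysVar.x 1 + (N + 1) • a, by simp [ha], ?_⟩
  rw [hrhs, MvPowerSeries.X, MvPowerSeries.coeff_add_monomial_mul, one_mul,
    coeff_sub_expSeries (constantCoeff_sum_X _ _) (le_max_left _ (N + 1))
      ((Nat.le_succ N).trans (le_max_right _ (N + 1)))]
  refine (Finset.sum_pos' (fun k _ => mul_nonneg (by positivity) (hnn.pow k _))
    ⟨N + 1, ?_, mul_pos (by positivity) (coeff_pow_pos hnn hpos (N + 1))⟩).ne'
  simp

/-- The tuple `g` contributes the monomial `x * u ^ c * ∏ y_(g i)` with positive coefficient, and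
non-negativity of the other terms excludes cancellation. -/
theorem depEdge_graft {k : ℕ} (hk : k ∈ Finset.Icc 1 N) (g : Fin k → Fin (L + 1)) (l : Fin k) :
    DepEdge (rhs C.poly) (C.graft k g) (g l) := by
  classical
  obtain ⟨j, hj⟩ := Fin.exists_succ_eq.2 (C.graft_ne_zero hk g)
  rw [← hj]
  set c := cen (C.rep j.succ)
  have hX : ∀ v : SysVar L, 0 < MvPowerSeries.coeff (Finsupp.single v 1)
      (MvPowerSeries.X v : MvPowerSeries (SysVar L) ℝ) := fun v => by
    simp [MvPowerSeries.coeff_X]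
  have hnn : ∀ (k : ℕ) (g : Fin k → Fin (L + 1)), NonnegCoeffs
      (if C.graft k g = j.succ then (k ! : ℝ)⁻¹ • (MvPowerSeries.X SysVar.u ^ c *
        ∏ i, MvPowerSeries.X (SysVar.y (g i))) else (0 : MvPowerSeries (SysVar L) ℝ)) := by
    intro k g
    split_ifs
    · exact (((NonnegCoeffs.X _).pow _).mul (NonnegCoeffs.prod fun _ _ => NonnegCoeffs.X _)).smul
        (by positivity)
    · intro e
      simp
  refine ⟨Finsupp.single SysVar.x 1 + (c • Finsupp.single SysVar.u 1 +
    ∑ i, Finsupp.single (SysVar.y (g i)) 1), ?_, ?_⟩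
  · have h1 : (1 : ℕ) ≤ ∑ i, (Finsupp.single (SysVar.y (g i)) 1 : SysVar L →₀ ℕ)
        (SysVar.y (g l)) := by
      refine le_trans (by simp) (Finset.single_le_sum
        (f := fun i => (Finsupp.single (SysVar.y (g i)) 1 : SysVar L →₀ ℕ) (SysVar.y (g l)))
        (fun _ _ => Nat.zero_le _) (Finset.mem_univ l))
    rw [Finsupp.add_apply, Finsupp.add_apply, Finsupp.finsetSum_apply]
    omega
  · rw [rhs, Fin.cons_succ, C.evalAt_poly, MvPowerSeries.X, MvPowerSeries.coeff_add_monomial_mul,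
      one_mul]
    refine (coeff_sum_pos (fun k _ => NonnegCoeffs.sum fun g _ => hnn k g) hk
      (coeff_sum_pos (fun g _ => hnn k g) (Finset.mem_univ g) ?_)).ne'
    rw [if_pos hj.symm, map_smul]
    exact mul_pos (by positivity) (coeff_mul_pos ((NonnegCoeffs.X _).pow _)
      (NonnegCoeffs.prod fun _ _ => NonnegCoeffs.X _) (coeff_pow_pos (NonnegCoeffs.X _) (hX _) _)
      (coeff_prod_pos (fun _ _ => NonnegCoeffs.X _) fun i _ => hX _))

/-- Structural induction works because, by `rep_subtree`, the branches of a representative are again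
representatives. Outside class `0` there is a first branch to descend into. -/
theorem reach_zero (t : PlaneTree) : ∀ i, C.rep i = t →
    Relation.ReflTransGen (DepEdge (rhs C.poly)) i 0 := by
  induction t with
  | node k f ih =>
    intro i hi
    by_cases h : i = 0
    · rw [h]
    · have h' := h
      rw [← C.cls_rep i, C.cls_eq_zero, not_not, hi, arity] at h
      have hsub := C.rep_subtree i k f hi
      have hgr : C.graft k (fun l => C.cls (f l)) = i := by
        rw [graft, C.cls_node, ← hi, C.cls_rep]
      have hedge := C.depEdge_graft (Finset.mem_Icc.2 h) (fun l => C.cls (f l)) ⟨0, h.1⟩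
      rw [hgr] at hedge
      exact Relation.ReflTransGen.head hedge (ih ⟨0, h.1⟩ _ (hsub _))

theorem stronglyConnected : StronglyConnected (DepEdge (rhs C.poly)) := fun i j =>
  (C.reach_zero _ i rfl).tail (C.depEdge_zero j)

end Classification

/-! ### Truncations form a finite classification -/

namespace PlaneTree

theorem trunc_node {N d k : ℕ} {f : Fin k → PlaneTree} (hk : 1 ≤ k ∧ k ≤ N) :
    trunc N (d + 1) (node k f) = node k fun i => trunc N d (f i) := by
  rw [trunc, if_pos hk]

theorem trunc_node_of_not {N d k : ℕ} {f : Fin k → PlaneTree} (hk : ¬ (1 ≤ k ∧ k ≤ N)) :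
    trunc N d (node k f) = leaf := by
  cases d
  · rw [trunc]
  · rw [trunc, if_neg hk]

theorem trunc_leaf {N d : ℕ} : trunc N d leaf = leaf := trunc_node_of_not (by omega)

theorem trunc_trunc (N : ℕ) : ∀ (d d' : ℕ) (t : PlaneTree),
    trunc N d (trunc N d' t) = trunc N (min d d') t
  | d, 0, t => by rw [trunc, trunc_leaf, min_eq_right (Nat.zero_le d), trunc]
  | 0, d' + 1, t => by rw [trunc, min_eq_left (Nat.zero_le _), trunc]
  | d + 1, d' + 1, node k f => by
    rw [← Nat.succ_eq_add_one d, ← Nat.succ_eq_add_one d', Nat.succ_min_succ]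
    by_cases hk : 1 ≤ k ∧ k ≤ N
    · rw [Nat.succ_eq_add_one, Nat.succ_eq_add_one, Nat.succ_eq_add_one, trunc_node hk,
        trunc_node hk, trunc_node hk]
      congr 1
      exact funext fun i => trunc_trunc N d d' (f i)
    · rw [trunc_node_of_not hk, trunc_node_of_not hk, trunc_leaf]

theorem finite_range_trunc (N d : ℕ) : (Set.range (trunc N d)).Finite := by
  induction d with
  | zero =>
    refine (Set.finite_singleton leaf).subset ?_
    rintro _ ⟨t, rfl⟩
    rw [trunc]
    rfl
  | succ d ih =>
    refine Set.Finite.subset ((Set.finite_singleton leaf).union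
      ((Set.finite_Iic N).biUnion fun k _ =>
        (Set.Finite.pi' fun _ : Fin k => ih).image (node k))) ?_
    rintro _ ⟨⟨k, f⟩, rfl⟩
    by_cases hk : 1 ≤ k ∧ k ≤ N
    · rw [trunc_node hk]
      exact Or.inr (Set.mem_biUnion (Set.mem_Iic.2 hk.2) ⟨_, fun i => ⟨f i, rfl⟩, rfl⟩)
    · rw [trunc_node_of_not hk]
      exact Or.inl rfl

theorem exists_classification {cen : PlaneTree → ℕ} {N d : ℕ}
    (hcen : ∀ t, cen (trunc N (d + 1) t) = cen t) :
    ∃ L, Nonempty (Classification cen N L) := by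
  classical
  have hfin : Finite (Set.range (trunc N (d + 1))) := (finite_range_trunc N (d + 1)).to_subtype
  obtain ⟨n, ⟨e⟩⟩ := Finite.exists_equiv_fin (Set.range (trunc N (d + 1)))
  have hleaf : leaf ∈ Set.range (trunc N (d + 1)) := ⟨leaf, trunc_leaf⟩
  cases n with
  | zero => exact (e ⟨leaf, hleaf⟩).elim0
  | succ L =>
    -- The swap moves the single-node tree to index `0`.
    let e' : Set.range (trunc N (d + 1)) ≃ Fin (L + 1) :=
      e.trans (Equiv.swap (e ⟨leaf, hleaf⟩) 0)
    have he' : e' ⟨leaf, hleaf⟩ = 0 := by simp [e']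
    have hfix : ∀ i, trunc N (d + 1) (e'.symm i : PlaneTree) = e'.symm i := by
      intro i
      obtain ⟨t, ht⟩ := (e'.symm i).2
      rw [← ht, trunc_trunc, min_self]
    refine ⟨L, ⟨⟨fun t => e' ⟨trunc N (d + 1) t, Set.mem_range_self t⟩, fun i => e'.symm i, ?_, ?_, ?_, ?_, ?_⟩⟩⟩
    · intro i
      exact (congrArg e' (Subtype.ext (hfix i))).trans (e'.apply_symm_apply i)
    · intro t
      rw [← he', e'.apply_eq_iff_eq, Subtype.ext_iff]
      change trunc N (d + 1) t = leaf ↔ _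
      cases t with
      | node k f =>
        rw [arity]
        constructor
        · intro h hk
          rw [trunc_node hk, leaf, node.injEq] at h
          omega
        · exact trunc_node_of_not
    · intro k f
      simp only [Equiv.symm_apply_apply]
      congr 2
      by_cases hk : 1 ≤ k ∧ k ≤ N
      · rw [trunc_node hk, trunc_node hk]
        congr 1
        funext i
        -- Truncating at depth `d + 1` cuts each branch at depth `d`, so replacing a branch by its
        -- own truncation at depth `d + 1` changes nothing.
        rw [trunc_trunc, min_eq_left (Nat.le_succ d)]
      · rw [trunc_node_of_not hk, trunc_node_of_not hk]
    · intro t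
      simp only [Equiv.symm_apply_apply]
      exact hcen t
    · intro i k f hi j
      simp only [Equiv.symm_apply_apply]
      have h := hfix i
      rw [hi] at h
      by_cases hk : 1 ≤ k ∧ k ≤ N
      · rw [trunc_node hk] at h
        have h2 := congrFun (node_injective k h) j
        rw [← h2, trunc_trunc, min_eq_right (Nat.le_succ d)]
      · rw [trunc_node_of_not hk, leaf, node.injEq] at h
        obtain ⟨rfl, -⟩ := h
        exact j.elim0

end PlaneTree

/-! ### Nodes of a plane tree -/

namespace PlaneTree

/-- The nodes of a plane tree. -/
inductive Vert : PlaneTree → Type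
  | root (t : PlaneTree) : Vert t
  | sub {k : ℕ} {f : Fin k → PlaneTree} (i : Fin k) (x : Vert (f i)) : Vert (node k f)

namespace Vert

def equivOption (k : ℕ) (f : Fin k → PlaneTree) :
    Vert (node k f) ≃ Option (Σ i, Vert (f i)) where
  toFun x := match x with
    | root _ => none
    | sub i x => some ⟨i, x⟩
  invFun x := match x with
    | none => root _
    | some ⟨i, x⟩ => sub i x
  left_inv x := by cases x <;> rfl
  right_inv x := by rcases x with _ | ⟨i, x⟩ <;> rfl

instance instFinite : ∀ t : PlaneTree, Finite (Vert t)
  | node k f =>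
    have : ∀ i, Finite (Vert (f i)) := fun i => instFinite (f i)
    Finite.of_equiv _ (equivOption k f).symm

theorem card_eq_size (t : PlaneTree) : Nat.card (Vert t) = size t := by
  induction t with
  | node k f ih =>
    rw [Nat.card_congr (equivOption k f), Finite.card_option, Nat.card_sigma, size, add_comm]
    simp_rw [ih]

/-- The list of child indices that leads from the root to a node. -/
def addr : {t : PlaneTree} → Vert t → List ℕ
  | _, root _ => []
  | _, sub i x => (i : ℕ) :: addr x

@[simp] theorem addr_root (t : PlaneTree) : addr (root t) = [] := by
  cases t; rfl

@[simp] theorem addr_sub {k : ℕ} {f : Fin k → PlaneTree} (i : Fin k) (x : Vert (f i)) :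
    addr (sub i x) = (i : ℕ) :: addr x := rfl

theorem addr_injective : ∀ {t : PlaneTree}, Function.Injective (addr (t := t))
  | node k f => fun x y h => by
    cases x with
    | root =>
      cases y with
      | root => rfl
      | sub j y => simp at h
    | sub i x =>
      cases y with
      | root => simp at h
      | sub j y =>
        simp only [addr_sub, List.cons.injEq] at h
        obtain ⟨h1, h2⟩ := h
        obtain rfl := Fin.ext h1
        rw [addr_injective h2]

theorem addr_eq_nil {t : PlaneTree} {x : Vert t} : addr x = [] ↔ x = root t :=
  ⟨fun h => addr_injective (h.trans (addr_root t).symm), fun h => h ▸ addr_root t⟩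

/-- `y` is a child of `x`. -/
def Child {t : PlaneTree} (x y : Vert t) : Prop := Edge t (some (addr x)) (some (addr y))

theorem Child.length {t : PlaneTree} {x y : Vert t} (h : Child x y) :
    (addr y).length = (addr x).length + 1 := by
  simpa [depth] using h.depth_eq

theorem not_child_root {t : PlaneTree} {x : Vert t} : ¬ Child x (root t) := fun h => by
  simpa using h.length

theorem child_root_sub {k : ℕ} {f : Fin k → PlaneTree} {i : Fin k} {y : Vert (f i)} :
    Child (root (node k f)) (sub i y) ↔ y = root (f i) := by
  rw [Child, addr_root, addr_sub, ← branch_none i, ← branch_some, edge_branch, edge_none,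
    Option.some.injEq, addr_eq_nil]

theorem child_sub_sub {k : ℕ} {f : Fin k → PlaneTree} {i : Fin k} {x y : Vert (f i)} :
    Child (sub i x) (sub i y) ↔ Child x y := by
  rw [Child, addr_sub, addr_sub, ← branch_some, ← branch_some, edge_branch, Child]

theorem child_sub_iff {k : ℕ} {f : Fin k → PlaneTree} {i : Fin k} {x : Vert (f i)}
    {y : Vert (node k f)} : Child (sub i x) y ↔ ∃ y', y = sub i y' ∧ Child x y' := by
  constructor
  · intro h
    cases y with
    | root => exact absurd h not_child_root
    | sub j y =>
      obtain ⟨hj, p, hp, -⟩ := edge_cons.1 h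
      have hji : i = j := by
        cases p with
        | none => simp at hp
        | some p =>
          simp only [addr_sub, branch_some, Option.some.injEq, List.cons.injEq] at hp
          exact Fin.ext hp.1
      subst hji
      exact ⟨y, rfl, child_sub_sub.1 h⟩
  · rintro ⟨y', rfl, h⟩
    exact child_sub_sub.2 h

theorem child_root_iff {k : ℕ} {f : Fin k → PlaneTree} {y : Vert (node k f)} :
    Child (root (node k f)) y ↔ ∃ i, y = sub i (root (f i)) := by
  constructor
  · intro h
    cases y with
    | root => exact absurd h not_child_root
    | sub j y => exact ⟨j, by rw [child_root_sub.1 h]⟩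
  · rintro ⟨i, rfl⟩
    exact child_root_sub.2 rfl

theorem exists_parent : ∀ {t : PlaneTree} (y : Vert t), y ≠ root t → ∃ x, Child x y
  | _, root _, h => absurd rfl h
  | node k f, sub i y, _ => by
    by_cases hy : y = root (f i)
    · exact ⟨root _, child_root_sub.2 hy⟩
    · obtain ⟨x, hx⟩ := exists_parent y hy
      exact ⟨sub i x, child_sub_sub.2 hx⟩

theorem Child.parent_unique {t : PlaneTree} {x x' y : Vert t} (h : Child x y)
    (h' : Child x' y) : x = x' :=
  addr_injective (Option.some.inj (Edge.parent_unique h h'))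

theorem mem_range_addr_of_edge : ∀ {t : PlaneTree} {p : Option (List ℕ)} {a : List ℕ},
    Edge t p (some a) → ∃ x : Vert t, addr x = a
  | node k f, p, [], _ => ⟨root _, rfl⟩
  | node k f, p, i :: a, h => by
    obtain ⟨hi, p', -, h'⟩ := edge_cons.1 h
    obtain ⟨x, rfl⟩ := mem_range_addr_of_edge h'
    exact ⟨sub (f := f) ⟨i, hi⟩ x, rfl⟩

end Vert

open Vert

/-! ### Compatible labelings and their total weight -/

section Labeling

variable {α : Type*} {R : α → α → Prop}

/-- The children of every node of `t` are labeled bijectively by the successors of its label. -/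
def Compat (R : α → α → Prop) : (t : PlaneTree) → (Vert t → α) → Prop
  | node _ f, σ => Function.Injective (fun i => σ (sub i (root (f i)))) ∧
      (∀ c, R (σ (root _)) c ↔ ∃ i, σ (sub i (root (f i))) = c) ∧
      ∀ i, Compat R (f i) (fun x => σ (sub i x))

theorem Compat.rel_iff : ∀ {t : PlaneTree} {σ : Vert t → α}, Compat R t σ → ∀ (x : Vert t) (u : α),
    R (σ x) u ↔ ∃ y, Child x y ∧ σ y = u
  | node k f, σ, h, root _, u => by
    rw [Compat] at h
    simp only [h.2.1, child_root_iff]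
    exact ⟨fun ⟨i, hi⟩ => ⟨_, ⟨i, rfl⟩, hi⟩, fun ⟨_, ⟨i, hi⟩, h⟩ => ⟨i, hi ▸ h⟩⟩
  | node k f, σ, h, sub i x, u => by
    rw [Compat] at h
    simp only [(h.2.2 i).rel_iff x u, child_sub_iff]
    exact ⟨fun ⟨y, hy, h⟩ => ⟨_, ⟨y, rfl, hy⟩, h⟩, fun ⟨_, ⟨y, hy, hxy⟩, h⟩ => ⟨y, hxy, hy ▸ h⟩⟩

theorem Compat.eq_of_child : ∀ {t : PlaneTree} {σ : Vert t → α}, Compat R t σ →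
    ∀ {x y y' : Vert t}, Child x y → Child x y' → σ y = σ y' → y = y'
  | node k f, σ, h, root _, y, y', hy, hy', hσ => by
    rw [Compat] at h
    obtain ⟨i, rfl⟩ := child_root_iff.1 hy
    obtain ⟨j, rfl⟩ := child_root_iff.1 hy'
    obtain rfl := h.1 hσ
    rfl
  | node k f, σ, h, sub i x, y, y', hy, hy', hσ => by
    rw [Compat] at h
    obtain ⟨z, rfl, hz⟩ := child_sub_iff.1 hy
    obtain ⟨z', rfl, hz'⟩ := child_sub_iff.1 hy'
    rw [(h.2.2 i).eq_of_child hz hz' hσ]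

theorem compat_of_rel_iff : ∀ {t : PlaneTree} {σ : Vert t → α}, Function.Injective σ →
    (∀ x u, R (σ x) u ↔ ∃ y, Child x y ∧ σ y = u) → Compat R t σ
  | node k f, σ, hσ, h => by
    rw [Compat]
    refine ⟨fun i j hij => ?_, fun c => ?_, fun i => compat_of_rel_iff ?_ fun x u => ?_⟩
    · have := hσ hij
      cases this
      rfl
    · simp only [h, child_root_iff]
      exact ⟨fun ⟨_, ⟨i, hi⟩, h⟩ => ⟨i, hi ▸ h⟩, fun ⟨i, hi⟩ => ⟨_, ⟨i, rfl⟩, hi⟩⟩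
    · intro x y hxy
      have := hσ hxy
      cases this
      rfl
    · simp only [h, child_sub_iff]
      exact ⟨fun ⟨_, ⟨y, hy, hxy⟩, h⟩ => ⟨y, hxy, hy ▸ h⟩, fun ⟨y, hy, h⟩ => ⟨_, ⟨y, rfl, hy⟩, h⟩⟩

/-- The number of compatible labelings in which the root has the label `v`. -/
def labelCount (R : α → α → Prop) (t : PlaneTree) (v : α) : ℕ :=
  Nat.card {σ : Vert t → α // Compat R t σ ∧ σ (root t) = v}

/-- The orderings of the successors of `v`. -/
def SuccOrdering (R : α → α → Prop) (k : ℕ) (v : α) : Type _ :=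
  {e : Fin k → α // Function.Injective e ∧ ∀ c, R v c ↔ ∃ i, e i = c}

def orderingEquiv (R : α → α → Prop) (k : ℕ) (v : α) :
    SuccOrdering R k v ≃ (Fin k ≃ {c // R v c}) where
  toFun e := Equiv.ofBijective (fun i => ⟨e.1 i, (e.2.2 _).2 ⟨i, rfl⟩⟩)
    ⟨fun i j h => e.2.1 (Subtype.ext_iff.1 h), fun ⟨c, hc⟩ => by
      obtain ⟨i, hi⟩ := (e.2.2 c).1 hc
      exact ⟨i, Subtype.ext hi⟩⟩
  invFun g := ⟨fun i => (g i).1, Subtype.val_injective.comp g.injective, fun c =>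
    ⟨fun hc => ⟨g.symm ⟨c, hc⟩, by simp⟩, fun ⟨i, hi⟩ => hi ▸ (g i).2⟩⟩
  left_inv _ := rfl
  right_inv _ := Equiv.ext fun _ => rfl

instance [Finite α] (k : ℕ) (v : α) : Finite (SuccOrdering R k v) :=
  inferInstanceAs (Finite {e : Fin k → α // Function.Injective e ∧ ∀ c, R v c ↔ ∃ i, e i = c})

theorem card_ordering [Finite α] (k : ℕ) (v : α) :
    Nat.card (SuccOrdering R k v) = if k = Nat.card {c // R v c} then k ! else 0 := by
  classical
  rw [Nat.card_congr (orderingEquiv R k v)]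
  have : Fintype {c // R v c} := Fintype.ofFinite _
  split_ifs with h
  · have e : Fin k ≃ {c // R v c} := (finCongr h).trans (Finite.equivFin _).symm
    rw [Nat.card_eq_fintype_card, Fintype.card_equiv e, Fintype.card_fin]
  · have : IsEmpty (Fin k ≃ {c // R v c}) := ⟨fun e => h (by
      rw [← Nat.card_congr e, Nat.card_eq_fintype_card, Fintype.card_fin])⟩
    exact Nat.card_of_isEmpty

/-- A compatible labeling with root label `v` amounts to an ordering of the successors of `v`
together with independent compatible labelings of the branches, each starting at its prescribed
successor. -/
theorem labelCount_node [Finite α] (k : ℕ) (f : Fin k → PlaneTree) (v : α)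
    [Fintype (SuccOrdering R k v)] :
    labelCount R (node k f) v = ∑ e : SuccOrdering R k v, ∏ i, labelCount R (f i) (e.1 i) := by
  let F : (Σ e : SuccOrdering R k v, ∀ i, {σ : Vert (f i) → α // Compat R (f i) σ ∧
      σ (root (f i)) = e.1 i}) → {σ : Vert (node k f) → α // Compat R (node k f) σ ∧
        σ (root _) = v} := fun p => ⟨fun x => match x with
      | root _ => v
      | sub i y => (p.2 i).1 y, by
    have h : ∀ i, (p.2 i).1 (root (f i)) = p.1.1 i := fun i => (p.2 i).2.2
    refine ⟨?_, rfl⟩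
    rw [Compat]
    simp only [h]
    exact ⟨p.1.2.1, p.1.2.2, fun i => (p.2 i).2.1⟩⟩
  have hF : Function.Bijective F := by
    constructor
    · rintro ⟨⟨e, he⟩, τ⟩ ⟨⟨e', he'⟩, τ'⟩ h
      have h1 : ∀ i x, (τ i).1 x = (τ' i).1 x := fun i x =>
        congrFun (Subtype.ext_iff.1 h) (sub i x)
      have h2 : e = e' := funext fun i =>
      (τ i).2.2.symm.trans ((h1 i _).trans (τ' i).2.2)
      subst h2
      congr 1
      exact funext fun i => Subtype.ext (funext (h1 i))
    · rintro ⟨σ, hσ, hv⟩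
      have hσ' := hσ
      rw [Compat, hv] at hσ'
      refine ⟨⟨⟨fun i => σ (sub i (root (f i))), hσ'.1, hσ'.2.1⟩,
        fun i => ⟨fun x => σ (sub i x), hσ'.2.2 i, rfl⟩⟩, Subtype.ext (funext fun x => ?_)⟩
      cases x with
      | root => exact hv.symm
      | sub i y => rfl
  rw [labelCount, ← Nat.card_congr (Equiv.ofBijective F hF), Nat.card_sigma]
  simp_rw [Nat.card_pi]
  rfl

def nodeEquiv : (Σ k, Fin k → PlaneTree) ≃ PlaneTree where
  toFun p := node p.1 p.2
  invFun t := match t with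
    | node k f => ⟨k, f⟩
  left_inv _ := rfl
  right_inv t := by cases t; rfl

theorem tsum_pi {X : Type*} : ∀ (k : ℕ) (g : Fin k → X → ℝ≥0∞),
    ∑' f : Fin k → X, ∏ i, g i (f i) = ∏ i, ∑' x, g i x
  | 0, g => by simp
  | k + 1, g => by
    rw [← (Fin.consEquiv fun _ => X).tsum_eq, Fin.prod_univ_succ, ← tsum_pi k, ENNReal.tsum_prod',
      ← ENNReal.tsum_mul_right]
    refine tsum_congr fun x => ?_
    rw [← ENNReal.tsum_mul_left]
    refine tsum_congr fun f => ?_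
    simp [Fin.prod_univ_succ, Fin.consEquiv]

theorem coe_wt_node (k : ℕ) (f : Fin k → PlaneTree) :
    (wt (node k f) : ℝ≥0∞) = (k ! : ℝ≥0∞)⁻¹ * ∏ i, (wt (f i) : ℝ≥0∞) := by
  rw [wt, ENNReal.coe_mul, ENNReal.coe_inv (by positivity), ENNReal.ofNNReal_finsetProd]
  simp

/-- The compatible labelings of all plane trees, weighted by `wt`, have total weight one. -/
theorem tsum_wt_mul_labelCount [Finite α] {ρ : α → ℕ} (hρ : ∀ u v, R u v → ρ v = ρ u + 1) :
    ∀ v : α, ∑' t, (wt t : ℝ≥0∞) * labelCount R t v = 1 := by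
  classical
  obtain ⟨B, hB⟩ := (Set.finite_range ρ).bddAbove
  have hB' : ∀ v, ρ v ≤ B := fun v => hB ⟨v, rfl⟩
  -- Finiteness bounds the rank `ρ`, and `R` raises it, so `B - ρ v` decreases on passing to
  -- successors.
  suffices h : ∀ (n : ℕ) (v : α), B - ρ v = n → ∑' t, (wt t : ℝ≥0∞) * labelCount R t v = 1 from
    fun v => h _ v rfl
  intro n
  induction n using Nat.strong_induction_on with
  | _ n ih =>
  intro v hv
  have hchild : ∀ c, R v c → ∑' t, (wt t : ℝ≥0∞) * labelCount R t c = 1 := fun c hc =>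
    ih (B - ρ c) (by have := hρ v c hc; have := hB' c; omega) c rfl
  rw [← nodeEquiv.tsum_eq, ENNReal.tsum_sigma']
  -- By induction the branches contribute a factor one for each ordering. Only the true number `k`
  -- of successors admits orderings, and their number `k!` cancels the weight.
  have hk : ∀ k, ∑' f : Fin k → PlaneTree, ((wt (node k f) : ℝ≥0∞) * labelCount R (node k f) v) =
      (k ! : ℝ≥0∞)⁻¹ * Nat.card (SuccOrdering R k v) := by
    intro k
    have : Fintype (SuccOrdering R k v) := Fintype.ofFinite _
    have h1 : ∀ f : Fin k → PlaneTree, (wt (node k f) : ℝ≥0∞) * labelCount R (node k f) v =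
        (k ! : ℝ≥0∞)⁻¹ * ∑ e : SuccOrdering R k v,
          ∏ i, ((wt (f i) : ℝ≥0∞) * labelCount R (f i) (e.1 i)) := by
      intro f
      rw [coe_wt_node, labelCount_node, mul_assoc]
      push_cast
      rw [Finset.mul_sum]
      simp_rw [Finset.prod_mul_distrib]
    simp_rw [h1]
    rw [ENNReal.tsum_mul_left, Summable.tsum_finsetSum fun _ _ => ENNReal.summable]
    congr 1
    have h2 : ∀ e : SuccOrdering R k v, ∑' f : Fin k → PlaneTree,
        ∏ i, ((wt (f i) : ℝ≥0∞) * labelCount R (f i) (e.1 i)) = 1 := by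
      intro e
      rw [tsum_pi k fun i t => (wt t : ℝ≥0∞) * labelCount R t (e.1 i)]
      exact Finset.prod_eq_one fun i _ => hchild _ ((e.2.2 _).2 ⟨i, rfl⟩)
    simp_rw [h2]
    simp
  have hk' : ∀ k, ∑' f : Fin k → PlaneTree, ((wt (nodeEquiv ⟨k, f⟩) : ℝ≥0∞) *
      labelCount R (nodeEquiv ⟨k, f⟩) v) = (k ! : ℝ≥0∞)⁻¹ * Nat.card (SuccOrdering R k v) := hk
  simp_rw [hk', card_ordering]
  rw [tsum_eq_single (Nat.card {c // R v c})]
  · rw [if_pos rfl]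
    exact ENNReal.inv_mul_cancel (by positivity) (ENNReal.natCast_ne_top _)
  · intro k hk
    simp [hk]

end Labeling

end PlaneTree

/-! ### Transport of occurrences; distances in trees -/

theorem occurrences_congr {W V V' : Type*} {M : SimpleGraph W} [Nontrivial W] (hM : M.Connected)
    {G : SimpleGraph V} {G' : SimpleGraph V'} (ψ : G ↪g G') (hψ : G'.support ⊆ Set.range ψ) :
    occurrences M G = occurrences M G' := by
  have hdeg : ∀ v, deg G' (ψ v) = deg G v := by
    intro v
    have : G'.neighborSet (ψ v) = ψ '' G.neighborSet v := by
      ext b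
      constructor
      · intro hb
        obtain ⟨a, rfl⟩ := hψ (G'.mem_support.2 ⟨_, SimpleGraph.Adj.symm hb⟩)
        exact ⟨a, ψ.map_rel_iff.1 hb, rfl⟩
      · rintro ⟨a, ha, rfl⟩
        exact ψ.map_rel_iff.2 ha
    rw [deg, this, Set.ncard_image_of_injective _ ψ.injective, deg]
  have hset : {S | IsOccurrence M G' S} = Set.image ψ '' {S | IsOccurrence M G S} := by
    ext S
    constructor
    · intro h
      have hS := h.subset_support hM
      obtain ⟨g, rfl, hg⟩ := h
      choose g' hg' using fun w => hψ (hS ⟨w, rfl⟩)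
      refine ⟨Set.range g', ⟨⟨⟨g', fun x y hxy => ?_⟩, ?_⟩, rfl, fun w hw => ?_⟩, ?_⟩
      · exact g.injective (by rw [← hg', ← hg', hxy])
      · intro a b
        change G.Adj (g' a) (g' b) ↔ _
        rw [← ψ.map_rel_iff, hg', hg', g.map_rel_iff]
      · change deg G (g' w) = _
        rw [← hg w hw, ← hg', hdeg]
      · rw [← Set.range_comp]
        exact congrArg Set.range (funext hg')
    · rintro ⟨_, ⟨g, rfl, hg⟩, rfl⟩
      refine ⟨ψ.comp g, Set.range_comp ψ g, fun w hw => ?_⟩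
      rw [← hg w hw]
      exact hdeg (g w)
  rw [occurrences, occurrences, hset, Set.ncard_image_of_injective _ ψ.injective.image_injective]

/-- Shortest walks to `p` and to `q`, extended to `v`, are both paths. A tree has only one path from
`r` to `v`, so their penultimate vertices agree. -/
theorem _root_.SimpleGraph.IsTree.eq_of_adj_of_dist {V : Type*} {G : SimpleGraph V} (hG : G.IsTree)
    {r p q v : V} (hp : G.Adj p v) (hq : G.Adj q v) (hpd : G.dist r v = G.dist r p + 1)
    (hqd : G.dist r v = G.dist r q + 1) : p = q := by
  obtain ⟨a, ha⟩ := hG.connected.exists_walk_length_eq_dist r p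
  obtain ⟨b, hb⟩ := hG.connected.exists_walk_length_eq_dist r q
  have h1 : (a.concat hp).IsPath := SimpleGraph.Walk.isPath_of_length_eq_dist _ (by simp [ha, hpd])
  have h2 : (b.concat hq).IsPath := SimpleGraph.Walk.isPath_of_length_eq_dist _ (by simp [hb, hqd])
  have h3 := (hG.existsUnique_path r v).unique h1 h2
  have h4 := congrArg SimpleGraph.Walk.penultimate h3
  simpa using h4

theorem _root_.SimpleGraph.dist_le_of_adj_le {V : Type*} {G : SimpleGraph V} {l : V → ℕ}
    (hl : ∀ u v, G.Adj u v → l v ≤ l u + 1) {u v : V} (h : G.Reachable u v) :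
    l v ≤ l u + G.dist u v := by
  obtain ⟨p, hp⟩ := h.exists_walk_length_eq_dist
  rw [← hp]
  clear hp h
  induction p with
  | nil => simp
  | cons h p ih =>
    have := hl _ _ h
    rw [SimpleGraph.Walk.length_cons]
    omega

/-! ### The nodes of a plane tree form a tree -/

namespace PlaneTree

open Vert

/-- The graph of a plane tree without the phantom node. -/
def vertGraph (t : PlaneTree) : SimpleGraph (Vert t) :=
  (graph t).comap fun x => some (addr x)

theorem vertGraph_adj {t : PlaneTree} {x y : Vert t} :
    (vertGraph t).Adj x y ↔ Child x y ∨ Child y x := Iff.rfl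

theorem exists_walk_root {t : PlaneTree} (n : ℕ) (x : Vert t) (hn : (addr x).length = n) :
    ∃ p : (vertGraph t).Walk (root t) x, p.length = n := by
  induction n generalizing x with
  | zero =>
    have hx : x = root t := addr_eq_nil.1 (List.length_eq_zero_iff.1 hn)
    subst hx
    exact ⟨SimpleGraph.Walk.nil, rfl⟩
  | succ n ih =>
    obtain ⟨y, hy⟩ := exists_parent x (by rintro rfl; simp at hn)
    have := hy.length
    obtain ⟨p, hp⟩ := ih y (by omega)
    exact ⟨p.concat (vertGraph_adj.2 (Or.inl hy)), by simp [hp]⟩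

theorem vertGraph_connected (t : PlaneTree) : (vertGraph t).Connected :=
  SimpleGraph.connected_iff_exists_forall_reachable _ |>.2
    ⟨root t, fun x => (exists_walk_root _ x rfl).elim fun p _ => p.reachable⟩

theorem vertGraph_dist (t : PlaneTree) (x : Vert t) :
    (vertGraph t).dist (root t) x = (addr x).length := by
  refine le_antisymm ?_ ?_
  · obtain ⟨p, hp⟩ := exists_walk_root _ x rfl
    exact hp ▸ SimpleGraph.dist_le p
  · have := SimpleGraph.dist_le_of_adj_le (G := vertGraph t) (l := fun x => (addr x).length)
      (fun u v h => by
        rcases vertGraph_adj.1 h with h | h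
        · exact h.length.le
        · have := h.length
          omega) ((vertGraph_connected t).preconnected (root t) x)
    simpa using this

theorem vertGraph_isTree (t : PlaneTree) : (vertGraph t).IsTree := by
  rw [SimpleGraph.isTree_iff_connected_and_card]
  refine ⟨vertGraph_connected t, le_antisymm ?_
    (vertGraph_connected t).card_vert_le_card_edgeSet_add_one⟩
  choose par hpar using fun y : {y : Vert t // y ≠ root t} => exists_parent y.1 y.2
  -- Every edge joins a non-root node to its parent, so there are fewer edges than nodes; a
  -- connected graph with so few edges is a tree.
  let F : {y : Vert t // y ≠ root t} → (vertGraph t).edgeSet := fun y =>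
    ⟨s(par y, y.1), vertGraph_adj.2 (Or.inl (hpar y))⟩
  have hF : Function.Surjective F := by
    rintro ⟨e, he⟩
    induction e using Sym2.ind with
    | _ x y =>
      rcases vertGraph_adj.1 he with h | h
      · refine ⟨⟨y, by rintro rfl; exact not_child_root h⟩, Subtype.ext ?_⟩
        change s(_, _) = _
        rw [(hpar _).parent_unique h]
      · refine ⟨⟨x, by rintro rfl; exact not_child_root h⟩, Subtype.ext ?_⟩
        change s(_, _) = _
        rw [(hpar _).parent_unique h, Sym2.eq_swap]
  have h1 := Nat.card_le_card_of_surjective F hF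
  have h2 : Nat.card {y : Vert t // y ≠ root t} < Nat.card (Vert t) := by
    have : ({y : Vert t | y ≠ root t}).ncard < (Set.univ : Set (Vert t)).ncard :=
      Set.ncard_lt_ncard (Set.ssubset_univ_iff.2 fun h =>
        (h ▸ Set.mem_univ (root t) : root t ∈ {y : Vert t | y ≠ root t}) rfl)
    rwa [Set.ncard_univ] at this
  omega

end PlaneTree

/-! ### Planted labeled trees as labeled plane trees -/

open PlaneTree Vert

namespace PlantedTree

variable {n : ℕ} (T : PlantedTree n)

/-- `v` is a child of `u`. -/
def Succ (u v : Fin n) : Prop :=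
  T.graph.Adj u v ∧ T.graph.dist T.root v = T.graph.dist T.root u + 1

theorem adj_iff_succ {u v : Fin n} : T.graph.Adj u v ↔ T.Succ u v ∨ T.Succ v u := by
  constructor
  · intro h
    rcases T.isTree.dist_eq_dist_add_one_of_adj T.root h with h' | h'
    · exact Or.inr ⟨h.symm, h'⟩
    · exact Or.inl ⟨h, h'⟩
  · rintro (h | h)
    · exact h.1
    · exact h.1.symm

theorem exists_succ {v : Fin n} (hv : v ≠ T.root) : ∃ u, T.Succ u v := by
  obtain ⟨p, hp⟩ := T.isTree.connected.exists_walk_length_eq_dist T.root v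
  have hnil : ¬ p.Nil := fun h => hv h.eq.symm
  refine ⟨p.penultimate, p.adj_penultimate hnil, ?_⟩
  have h1 := SimpleGraph.dist_le p.dropLast
  have h2 : p.dropLast.length + 1 = p.length := SimpleGraph.Walk.length_dropLast_add_one hnil
  rcases T.isTree.dist_eq_dist_add_one_of_adj T.root (p.adj_penultimate hnil) with h | h <;> omega

/-- `T` is the plane tree `t` with the labels `σ`. -/
structure IsLabeling (t : PlaneTree) (σ : Vert t → Fin n) : Prop where
  bijective : Function.Bijective σ
  root_eq : σ (Vert.root t) = T.root
  adj_iff : ∀ x y, T.graph.Adj (σ x) (σ y) ↔ (vertGraph t).Adj x y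

variable {T}

theorem dist_of_compat {t : PlaneTree} {σ : Vert t → Fin n} (h : Compat T.Succ t σ)
    (hr : σ (Vert.root t) = T.root) (x : Vert t) :
    T.graph.dist T.root (σ x) = (addr x).length := by
  induction hm : (addr x).length generalizing x with
  | zero =>
    rw [addr_eq_nil.1 (List.length_eq_zero_iff.1 hm), hr, SimpleGraph.dist_self]
  | succ m ih =>
    obtain ⟨y, hy⟩ := exists_parent x (by rintro rfl; simp at hm)
    have := hy.length
    rw [((h.rel_iff y (σ x)).2 ⟨x, hy, rfl⟩).2, ih y (by omega)]

/-- Depth in `t` equals distance from the root in `T`. Injectivity follows by induction on depth: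
equal labels have equal parent labels, and siblings carry distinct labels. Surjectivity follows by
induction on the distance. -/
theorem isLabeling_of_compat {t : PlaneTree} {σ : Vert t → Fin n} (h : Compat T.Succ t σ)
    (hr : σ (Vert.root t) = T.root) : T.IsLabeling t σ := by
  have hinj : Function.Injective σ := by
    intro x y hxy
    have hlen : (addr x).length = (addr y).length := by
      rw [← dist_of_compat h hr, ← dist_of_compat h hr, hxy]
    induction hm : (addr x).length generalizing x y with
    | zero =>
      rw [addr_eq_nil.1 (List.length_eq_zero_iff.1 hm),
        addr_eq_nil.1 (List.length_eq_zero_iff.1 (hlen.symm.trans hm))]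
    | succ m ih =>
      obtain ⟨x', hx'⟩ := exists_parent x (by rintro rfl; simp at hm)
      obtain ⟨y', hy'⟩ := exists_parent y (by rintro rfl; rw [hlen] at hm; simp at hm)
      have h1 := hx'.length
      have h2 := hy'.length
      have hx2 := (h.rel_iff x' (σ x)).2 ⟨x, hx', rfl⟩
      have hy2 := (h.rel_iff y' (σ y)).2 ⟨y, hy', rfl⟩
      rw [← hxy] at hy2
      have hpar := ih (T.isTree.eq_of_adj_of_dist hx2.1 hy2.1 hx2.2 hy2.2) (by omega) (by omega)
      subst hpar
      exact h.eq_of_child hx' hy' hxy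
  have hsurj : Function.Surjective σ := by
    intro v
    induction hm : T.graph.dist T.root v generalizing v with
    | zero =>
      exact ⟨Vert.root t, by rw [hr, (T.isTree.connected.dist_eq_zero_iff).1 hm]⟩
    | succ m ih =>
      obtain ⟨u, hu⟩ := T.exists_succ (v := v) (by rintro rfl; simp at hm)
      obtain ⟨x, rfl⟩ := ih u (by have := hu.2; omega)
      obtain ⟨y, -, hy⟩ := (h.rel_iff x v).1 hu
      exact ⟨y, hy⟩
  have hsucc : ∀ x y, T.Succ (σ x) (σ y) ↔ Child x y := fun x y => by
    rw [h.rel_iff]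
    exact ⟨fun ⟨z, hz, hzy⟩ => hinj hzy ▸ hz, fun h => ⟨y, h, rfl⟩⟩
  exact ⟨⟨hinj, hsurj⟩, hr, fun x y => by rw [adj_iff_succ, hsucc, hsucc, vertGraph_adj]⟩

namespace IsLabeling

variable {t : PlaneTree} {σ : Vert t → Fin n} (h : T.IsLabeling t σ)
include h

/-- A labeling is a graph isomorphism that matches the roots, so it preserves distances from the
root and hence the direction of every edge. -/
theorem compat : Compat T.Succ t σ := by
  let e : vertGraph t ≃g T.graph := ⟨Equiv.ofBijective σ h.bijective, h.adj_iff _ _⟩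
  have hdist : ∀ x, T.graph.dist T.root (σ x) = (addr x).length := by
    intro x
    rw [← vertGraph_dist, ← h.root_eq]
    refine le_antisymm ?_ ?_
    · obtain ⟨p, hp⟩ := (vertGraph_connected t).exists_walk_length_eq_dist (Vert.root t) x
      rw [← hp, ← SimpleGraph.Walk.length_map e.toHom p]
      exact SimpleGraph.dist_le _
    · obtain ⟨p, hp⟩ := T.isTree.connected.exists_walk_length_eq_dist (e (Vert.root t)) (e x)
      have := SimpleGraph.dist_le (p.map e.symm.toHom)
      rw [SimpleGraph.Walk.length_map, hp] at this
      have h' : (vertGraph t).dist (Vert.root t) x ≤ T.graph.dist (e (Vert.root t)) (e x) := by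
        simpa using this
      exact h'
  refine compat_of_rel_iff h.bijective.1 fun x u => ?_
  obtain ⟨y, rfl⟩ := h.bijective.2 u
  rw [Succ, h.adj_iff, hdist, hdist, vertGraph_adj]
  constructor
  · rintro ⟨hxy | hxy, hl⟩
    · exact ⟨y, hxy, rfl⟩
    · have := hxy.length
      omega
  · rintro ⟨z, hz, hzy⟩
    obtain rfl := h.bijective.1 hzy
    exact ⟨Or.inl hz, hz.length⟩

theorem occurrences_eq {W : Type*} {M : SimpleGraph W} [Nontrivial W] (hM : M.Connected) :
    occurrences M T.plantedGraph = occurrences M (PlaneTree.graph t) := by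
  let e := Equiv.ofBijective σ h.bijective
  have he : ∀ x, e x = σ x := fun _ => rfl
  have hadj : ∀ u v, T.graph.Adj u v ↔
      (PlaneTree.graph t).Adj (some (addr (e.symm u))) (some (addr (e.symm v))) := by
    intro u v
    rw [← e.apply_symm_apply u, ← e.apply_symm_apply v, he, he, h.adj_iff]
    simp [vertGraph, ← he]
  have hroot : ∀ v, v = T.root ↔ (some (addr (e.symm v)) : Option (List ℕ)) = some [] := by
    intro v
    rw [Option.some.injEq, addr_eq_nil, ← h.root_eq, e.symm_apply_eq, he]
  refine occurrences_congr hM (G := T.plantedGraph) (G' := PlaneTree.graph t)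
    ⟨⟨fun v => v.map fun u => addr (e.symm u),
      Option.map_injective (addr_injective.comp e.symm.injective)⟩, ?_⟩ ?_
  · rintro (_ | u) (_ | v)
    · simp
    · exact (graph_adj_none.trans (hroot v).symm)
    · exact (SimpleGraph.adj_comm _ _ _).trans (graph_adj_none.trans (hroot u).symm)
    · exact (hadj u v).symm
  · rintro (_ | a) ha
    · exact ⟨none, rfl⟩
    · obtain ⟨p, hp⟩ : ∃ p, Edge t p (some a) := by
        obtain ⟨b, hb | hb⟩ := ha
        · exact hb.exists_parent (by simp)
        · exact ⟨b, hb⟩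
      obtain ⟨x, rfl⟩ := mem_range_addr_of_edge hp
      exact ⟨some (e x), congrArg some (congrArg addr (e.symm_apply_apply x))⟩

end IsLabeling

theorem eq_of_isLabeling {T T' : PlantedTree n} {t : PlaneTree} {σ : Vert t → Fin n}
    (h : T.IsLabeling t σ) (h' : T'.IsLabeling t σ) : T = T' := by
  have hg : T.graph = T'.graph := by
    ext u v
    obtain ⟨x, rfl⟩ := h.bijective.2 u
    obtain ⟨y, rfl⟩ := h.bijective.2 v
    rw [h.adj_iff, h'.adj_iff]
  have hr := h.root_eq.symm.trans h'.root_eq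
  cases T
  cases T'
  simp only at hg hr
  subst hg hr
  rfl

theorem exists_isLabeling {t : PlaneTree} {σ : Vert t → Fin n} (hσ : Function.Bijective σ) :
    ∃ T : PlantedTree n, T.IsLabeling t σ := by
  let e := Equiv.ofBijective σ hσ
  have he : ∀ x, e.symm (σ x) = x := e.symm_apply_apply
  refine ⟨⟨(vertGraph t).comap e.symm, ?_, σ (Vert.root t)⟩, hσ, rfl, fun x y => ?_⟩
  · exact (SimpleGraph.Iso.isTree_iff (SimpleGraph.Iso.comap e.symm (vertGraph t))).2
      (vertGraph_isTree t)
  · simp [he]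

instance : Finite (PlantedTree n) :=
  Finite.of_injective (fun T : PlantedTree n => (T.graph, T.root)) fun T T' h => by
    cases T
    cases T'
    simp only [Prod.mk.injEq] at h
    obtain ⟨rfl, rfl⟩ := h
    rfl

variable {W : Type*} {M : SimpleGraph W} [Nontrivial W]

/-- A bijective labeling of `t` determines the planted tree, and every compatible labeling is
bijective. The pairs counted on the left are therefore all bijections from the nodes to the labels.
-/
theorem sum_labelCount (hM : M.Connected) (n m : ℕ) (t : PlaneTree)
    [Fintype {T : PlantedTree n // occurrences M T.plantedGraph = m}] :
    ∑ T : {T : PlantedTree n // occurrences M T.plantedGraph = m},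
      labelCount T.1.Succ t T.1.root =
    if size t = n ∧ occurrences M (PlaneTree.graph t) = m then n ! else 0 := by
  classical
  simp_rw [labelCount]
  rw [← Nat.card_sigma]
  split_ifs with h
  · obtain ⟨hn, hm⟩ := h
    let F : (Σ T : {T : PlantedTree n // occurrences M T.plantedGraph = m},
        {σ : Vert t → Fin n // Compat T.1.Succ t σ ∧ σ (Vert.root t) = T.1.root}) →
        (Vert t ≃ Fin n) := fun p =>
      Equiv.ofBijective p.2.1 (isLabeling_of_compat p.2.2.1 p.2.2.2).bijective
    have hF : Function.Bijective F := by
      constructor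
      · rintro ⟨⟨T, hT⟩, ⟨σ, hσ⟩⟩ ⟨⟨T', hT'⟩, ⟨σ', hσ'⟩⟩ heq
        have h1 : σ = σ' := congrArg DFunLike.coe heq
        subst h1
        have h2 := eq_of_isLabeling (isLabeling_of_compat hσ.1 hσ.2)
          (isLabeling_of_compat hσ'.1 hσ'.2)
        subst h2
        rfl
      · intro e
        obtain ⟨T, hT⟩ := exists_isLabeling e.bijective
        exact ⟨⟨⟨T, (hT.occurrences_eq hM).trans hm⟩, ⟨e, hT.compat, hT.root_eq⟩⟩,
          Equiv.ext fun _ => rfl⟩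
    rw [Nat.card_congr (Equiv.ofBijective F hF)]
    have : Fintype (Vert t) := Fintype.ofFinite _
    have e : Vert t ≃ Fin n := (Finite.equivFin _).trans (finCongr ((card_eq_size t).trans hn))
    rw [Nat.card_eq_fintype_card, Fintype.card_equiv e, ← Nat.card_eq_fintype_card,
      card_eq_size, hn]
  · rw [Nat.card_eq_zero]
    refine Or.inl ⟨?_⟩
    rintro ⟨⟨T, hT⟩, ⟨σ, hσ⟩⟩
    have hlab := isLabeling_of_compat hσ.1 hσ.2
    refine h ⟨?_, (hlab.occurrences_eq hM).symm.trans hT⟩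
    rw [← card_eq_size, Nat.card_congr (Equiv.ofBijective σ hlab.bijective), Nat.card_fin]

/-- Double counting: each planted tree is counted with the total weight one of its compatible
labelings, and the two sums are exchanged. -/
theorem plantedCount_eq (hM : M.Connected) (n m : ℕ) :
    (plantedCount M n m : ℝ≥0∞) = ∑' t, (wt t : ℝ≥0∞) *
      (if size t = n ∧ occurrences M (PlaneTree.graph t) = m then n ! else 0 : ℕ) := by
  have : Fintype {T : PlantedTree n // occurrences M T.plantedGraph = m} := Fintype.ofFinite _
  simp_rw [← sum_labelCount hM n m]
  push_cast
  simp_rw [Finset.mul_sum]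
  rw [Summable.tsum_finsetSum fun _ _ => ENNReal.summable]
  have h1 : ∀ T : PlantedTree n, ∑' t, (wt t : ℝ≥0∞) * labelCount T.Succ t T.root = 1 :=
    fun T => tsum_wt_mul_labelCount (ρ := T.graph.dist T.root) (fun _ _ h => h.2) T.root
  simp_rw [h1]
  rw [plantedCount, ← Nat.card_coe_set_eq]
  simp only [Finset.sum_const, nsmul_eq_mul, mul_one, Finset.card_univ, ← Nat.card_eq_fintype_card]
  rfl

end PlantedTree

theorem plantedSeries_eq {W : Type*} {M : SimpleGraph W} [Nontrivial W] (hM : M.Connected) :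
    plantedSeries M =
      gf (bisize fun t => occurrences M (PlaneTree.graph t)) fun t => (wt t : ℝ) := by
  classical
  ext e
  set occ : PlaneTree → ℕ := fun t => occurrences M (PlaneTree.graph t) with hocc
  have hiff : ∀ t, bisize occ t = e ↔ size t = e 0 ∧ occ t = e 1 := by
    intro t
    constructor
    · rintro rfl
      simp [bisize]
    · rintro ⟨h0, h1⟩
      ext i
      fin_cases i
      · simp [bisize, h0]
      · simp [bisize, h1]
  set s := (finiteFibers_bisize occ e).toFinset with hs
  have hmem : ∀ t, t ∈ s ↔ bisize occ t = e := fun t => by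
    rw [hs, Set.Finite.mem_toFinset]
    rfl
  rw [coeff_gf_eq_sum (s := s) fun t ht => (hmem t).2 ht,
    Finset.filter_true_of_mem fun t ht => (hmem t).1 ht]
  change (plantedCount M (e 0) (e 1) : ℝ) / ((e 0)! : ℝ) = _
  have h1 := PlantedTree.plantedCount_eq hM (e 0) (e 1)
  rw [tsum_eq_sum (s := s)] at h1
  · have h2 : (plantedCount M (e 0) (e 1) : ℝ≥0) = ∑ t ∈ s, wt t * ((e 0)! : ℝ≥0) := by
      rw [← ENNReal.coe_inj]
      push_cast
      rw [h1]
      refine Finset.sum_congr rfl fun t ht => ?_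
      rw [if_pos ((hiff t).1 ((hmem t).1 ht))]
    have h3 : (plantedCount M (e 0) (e 1) : ℝ) = (∑ t ∈ s, (wt t : ℝ)) * ((e 0)! : ℝ) := by
      rw [Finset.sum_mul]
      exact_mod_cast h2
    rw [h3, mul_div_cancel_right₀ _ (by positivity)]
  · intro t ht
    rw [if_neg fun h => ht ((hmem t).2 ((hiff t).2 h))]
    simp

end

end TreePattern

/-! ### Assembly -/

open TreePattern TreePattern.PlaneTree in
theorem proposition1 {W : Type*} [Fintype W] (M : SimpleGraph W) (hM : M.IsTree)
    (hcard : 3 ≤ Fintype.card W) :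
    ∃ (L : ℕ) (a : Fin (L + 1) → TreePattern.SeriesXU) (P : Fin L → TreePattern.PolyYU L),
      TreePattern.plantedSeries M = ∑ j, a j ∧
      (∀ j, MvPowerSeries.constantCoeff (a j) = 0) ∧
      (∀ j e, 0 ≤ MvPolynomial.coeff e (P j)) ∧
      a 0 = TreePattern.varX * TreePattern.expSeries (∑ i, a i)
          - TreePattern.varX * ∑ j, (P j).evalAt a 1 ∧
      (∀ j : Fin L, a j.succ = TreePattern.varX * (P j).evalAt a TreePattern.varU) ∧
      TreePattern.CoeffLE
        (∑ j, (P j).evalAt (fun i : Fin (L + 1) => (MvPowerSeries.X i : MvPowerSeries _ ℝ)) 1)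
        (TreePattern.expSeries (∑ i : Fin (L + 1), MvPowerSeries.X i)) ∧
      TreePattern.StronglyConnected (TreePattern.DepEdge (TreePattern.rhs P)) := by
  have : Nontrivial W := Fintype.one_lt_card_iff_nontrivial.1 (by omega)
  have hcon := hM.connected
  -- The order `|W|` bounds both the degrees of internal nodes and the lengths of paths in the
  -- pattern, so it serves as arity bound and, increased by one, as truncation depth.
  obtain ⟨L, ⟨C⟩⟩ := exists_classification (cen := centralCount M) (N := Fintype.card W)
    (d := Fintype.card W) (centralCount_trunc hcon hcard le_rfl (Nat.le_succ _))
  have hocc := occurrences_node hcon hcard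
  refine ⟨L, C.series fun t => occurrences M (graph t), C.poly, ?_, C.constantCoeff_series,
    C.coeff_poly_nonneg, C.series_zero hocc ?_, C.series_succ hocc, C.coeffLE,
    C.stronglyConnected⟩
  · rw [plantedSeries_eq hcon, C.sum_series]
  · rintro ⟨k, f⟩ hk
    exact centralCount_eq_zero le_rfl f hk
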